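/- Setting. Let $\mathcal O=(a_{ij})\in\mathbb R^{m\times m}$ and $\beta^T=(\beta_1,\dots,\beta_m)$ be the coefficient matrix and the weights of an $m$-stage Runge–Kutta method, with $\mathbb 1=(1,\dots,1)^T$, $$r(z)=1+z\,\beta^T(I-z\mathcal O)^{-1}\mathbb 1,\qquad q(z)=(q_1(z),\dots,q_m(z))=\beta^T(I-z\mathcal O)^{-1}.$$ Assume that all eigenvalues of $\mathcal O$ have positive real part, that $r'(0)=1$, and that the method is L-stable: $|r(z)|\le 1$ for $\operatorname{Re}z\le 0$ and $r(\infty)=0$. Let $A$ be a matrix, or more generally a bounded operator on a complex Banach space $E$, that is sectorial: for some real $M$ and some $0\le\varphi<\frac\pi2$, $\lambda+A$ is invertible with $\|(\lambda+A)^{-1}\|\le M/|\lambda|$ for all $\lambda\ne0$ with $|\arg\lambda|\le\pi-\varphi$. Let $d>0$ and $0<\alpha-d<\alpha+d<\frac\pi2-\varphi$. For $\mu>0$ put $$\gamma(w)=\mu\,(1-\sin(\alpha+iw)),\qquad D_d=\{w\in\mathbb C:|\operatorname{Im}w|\le d\},\qquad \Omega_\mu=\gamma(D_d).$$ For $h>0$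 and $n\in\mathbb N$ let $$G_{h,n}(w)=\frac1{2\pi i}\,(\gamma(w)+A)^{-1}\,r(h\gamma(w))^n\,q(h\gamma(w))\,\gamma'(w),$$ a row of $m$ operators on $E$, i.e. an operator $E^m\to E$. For $\tau>0$ and an integer $K\ge1$ let $$E_{\tau,K}(G)=\int_{-\infty}^{\infty}G(x)\,dx-\tau\sum_{k=-K}^{K}G(k\tau).$$ Here $E^m$ and $\mathbb C^m$ carry the $\ell^p$ norm for some fixed $p\in[1,\infty]$, and the norms of $G_{h,n}(w):E^m\to E$ and of the row vector $q(z):\mathbb C^m\to\mathbb C$ are the operator norms. Theorem 3. (i) There exist $\rho>0$ and $b>0$ (depending only on the method, $\alpha$ and $d$) such that, for all $0<\delta\le\rho$ and all $z\in\Omega_\delta$, the matrix $I-z\mathcal O$ is invertible and $$|r(z)|\le\frac{e^{2\delta}}{1+b|z|}.\qquad(*)$$ (ii) Let $\rho,b>0$ be any constants with the property in (i). Then $\max_{z\in\Omega_\rho}\|q(z)\|$ exists. Put $$C_0=\frac M{2\pi}\sqrt{\frac{1+\sin(\alpha+d)}{1-\sin(\alpha+d)}}\;\max_{z\in\Omega_\rho}\|q(z)\|,\quad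 C=20\,C_0,\quad a_0=2+\tfrac32b,\quad a_1=2+2b,\quad a_2=\tfrac12b.$$ For all $\mu,h>0$ with $h\mu\le\rho$, all $n\in\mathbb N$, $t=nh$ with $n/2\ge b\mu t\ge1$, all $\tau>0$ and all $K\ge1$, the function $G_{h,n}$ is integrable over $\mathbb R$ and $$\|E_{\tau,K}(G_{h,n})\|\le C\left(\frac{e^{a_0\mu t}}{e^{2\pi d/\tau}-1}+e^{(a_1-a_2\cosh(K\tau))\mu t}+e^{a_1\mu t}\Bigl(1+\frac{b\mu t}n\cosh(K\tau)\Bigr)^{-(n-1)}\right).$$ -/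

import Mathlib

open scoped ENNReal

noncomputable section

/-- The coefficients of an `m`-stage Runge-Kutta method: the Runge-Kutta matrix `a`, the weights
`b` and the nodes `c`. -/
structure RKMethod (m : ℕ) where
  a : Matrix (Fin m) (Fin m) ℝ
  b : Fin m → ℝ
  c : Fin m → ℝ

namespace RKMethod

variable {m : ℕ}

/-- The Runge-Kutta matrix with its entries regarded as complex numbers. -/
def aC (R : RKMethod m) : Matrix (Fin m) (Fin m) ℂ :=
  R.a.map (fun x : ℝ => (x : ℂ))

/-- The weights regarded as complex numbers. -/
def bC (R : RKMethod m) : Fin m → ℂ :=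
  fun j => (R.b j : ℂ)

/-- The row vector `q(z) = bᵀ (I - z 𝒪)⁻¹`. -/
def q (R : RKMethod m) (z : ℂ) : Fin m → ℂ :=
  Matrix.vecMul R.bC (1 - z • R.aC)⁻¹

/-- The stability function `r(z) = 1 + z bᵀ (I - z 𝒪)⁻¹ 𝟙`. -/
def r (R : RKMethod m) (z : ℂ) : ℂ :=
  1 + z * (R.q z ⬝ᵥ (fun _ => 1))

/-- The row vector `q(z)` as a linear functional on `ℂᵐ` with the `ℓᵖ` norm; its norm
is the operator norm of the row vector. -/
def qRow (R : RKMethod m) (p : ℝ≥0∞) [Fact (1 ≤ p)] (z : ℂ) :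
    PiLp p (fun _ : Fin m => ℂ) →L[ℂ] ℂ :=
  ∑ i, R.q z i • PiLp.proj p (𝕜 := ℂ) (fun _ : Fin m => ℂ) i

/-- L-stability: `|r(z)| ≤ 1` for `Re z ≤ 0`, and `r(∞) = 0`. -/
def IsLStable (R : RKMethod m) : Prop :=
  (∀ z : ℂ, z.re ≤ 0 → ‖R.r z‖ ≤ 1) ∧ Filter.Tendsto R.r (Filter.cocompact ℂ) (nhds 0)

end RKMethod

/-- The bounded operator `A` is sectorial with constant `M`, angle `φ` and shift `0`:
`λ + A` is invertible with `‖(λ + A)⁻¹‖ ≤ M / |λ|` for all `λ ≠ 0` with `|arg λ| ≤ π - φ`. -/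
def IsSectorial {E : Type*} [NormedAddCommGroup E] [NormedSpace ℂ E]
    (A : E →L[ℂ] E) (M φ : ℝ) : Prop :=
  ∀ l : ℂ, l ≠ 0 → |l.arg| ≤ Real.pi - φ →
    IsUnit (algebraMap ℂ (E →L[ℂ] E) l + A) ∧
      ‖Ring.inverse (algebraMap ℂ (E →L[ℂ] E) l + A)‖ ≤ M / ‖l‖

/-- The parametrization `γ(w) = μ (1 - sin(α + i w))`. -/
def hyperbola (α μ : ℝ) (w : ℂ) : ℂ :=
  μ * (1 - Complex.sin (α + Complex.I * w))

/-- The closed strip `D_d = {w : |Im w| ≤ d}`. -/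
def strip (d : ℝ) : Set ℂ :=
  {w | |w.im| ≤ d}

/-- The region `Ω_μ = γ(D_d)`. -/
def hypRegion (α d μ : ℝ) : Set ℂ :=
  hyperbola α μ '' strip d

/-- `ρ` and `b` are admissible constants for the stability function `r` of the method:
they are positive and, for all `0 < δ ≤ ρ` and all `z ∈ Ω_δ`, the point `z` is not a pole of the
resolvent-type function `(I - z 𝒪)⁻¹` and `|r(z)| ≤ e^{2δ} / (1 + b |z|)`. -/
def IsAdmissible {m : ℕ} (R : RKMethod m) (α d ρ b : ℝ) : Prop :=
  0 < ρ ∧ 0 < b ∧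
    ∀ δ : ℝ, 0 < δ → δ ≤ ρ → ∀ z ∈ hypRegion α d δ,
      (1 - z • R.aC).det ≠ 0 ∧ ‖R.r z‖ ≤ Real.exp (2 * δ) / (1 + b * ‖z‖)

/-- The set of values `‖q(z)‖`, `z ∈ Ω_ρ`. -/
def qValues {m : ℕ} (R : RKMethod m) (p : ℝ≥0∞) [Fact (1 ≤ p)] (α d ρ : ℝ) : Set ℝ :=
  (fun z => ‖R.qRow p z‖) '' hypRegion α d ρ

/-- The constant
`C₀ = M / (2π) * √((1 + sin(α + d)) / (1 - sin(α + d))) * max_{z ∈ Ω_ρ} ‖q(z)‖`. -/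
def constC₀ {m : ℕ} (R : RKMethod m) (p : ℝ≥0∞) [Fact (1 ≤ p)] (M α d ρ : ℝ) : ℝ :=
  M / (2 * Real.pi) *
    Real.sqrt ((1 + Real.sin (α + d)) / (1 - Real.sin (α + d))) * sSup (qValues R p α d ρ)

/-- The integrand
`G_{h,n}(w) = (2πi)⁻¹ (γ(w) + A)⁻¹ r(h γ(w))ⁿ q(h γ(w)) γ'(w)`, a row of `m` operators on `E`,
regarded as the operator `(g₁, …, g_m) ↦ ∑ᵢ Gᵢ gᵢ` from `Eᵐ` with the `ℓᵖ` norm to `E`. -/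
def integrandG {m : ℕ} (R : RKMethod m) (p : ℝ≥0∞) [Fact (1 ≤ p)]
    {E : Type*} [NormedAddCommGroup E] [NormedSpace ℂ E]
    (A : E →L[ℂ] E) (α μ h : ℝ) (n : ℕ) (w : ℂ) :
    PiLp p (fun _ : Fin m => E) →L[ℂ] E :=
  ∑ i, ((2 * Real.pi * Complex.I)⁻¹ * R.r (h * hyperbola α μ w) ^ n *
      R.q (h * hyperbola α μ w) i * deriv (hyperbola α μ) w) •
    (Ring.inverse (algebraMap ℂ (E →L[ℂ] E) (hyperbola α μ w) + A)).comp
      (PiLp.proj p (𝕜 := ℂ) (fun _ : Fin m => E) i)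

/-- The quadrature error of the truncated trapezoidal rule,
`E_{τ,K}(G) = ∫_{-∞}^{∞} G(x) dx - τ ∑_{k=-K}^{K} G(kτ)`. -/
def quadError {X : Type*} [NormedAddCommGroup X] [NormedSpace ℝ X]
    (τ : ℝ) (K : ℕ) (G : ℝ → X) : X :=
  (∫ x : ℝ, G x) - τ • ∑ k ∈ Finset.Icc (-(K : ℤ)) (K : ℤ), G (k * τ)

end

/-!
The integrand `G` is holomorphic on the strip `|Im w| ≤ d`, and there

  `‖G(w)‖ ≤ C₀ |r(h γ(w))|ⁿ ≤ C₀ e^{2μt} (1 + ε (cosh x - 1))⁻ⁿ`,  `x = Re w`, `ε = b h μ`,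

because `|γ(w)| = μ (cosh x - sin (α - Im w))` and `|γ'|/|γ|` is at most the square root in `C₀`
(`norm_integrandG_le`, `norm_r_pow_le`). The hypotheses on `n` and `t` say that `nε ≥ 1` and
`ε ≤ 1/2`.

*The infinite trapezoidal rule.* By Poisson summation the error is the sum of the Fourier
coefficients of `G` at the nonzero multiples of `1/τ`, and moving the line of integration to
`Im w = ±d` bounds these by powers of `e^{-2πd/τ}` (`norm_integral_sub_tsum_le`); continuous
functionals reduce the operator-valued case to the scalar one. Here `nε ≥ 1` and Bernoulli's
inequality give the integrable majorant `2 / (1 + x²)`.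

*The truncation.* Since `(1 + ε (cosh x - 1))⁻ⁿ ≤ e^{2nε} (1 + ε cosh x)⁻ⁿ`, the neglected terms
are bounded by an integral of `(1 + ε cosh x)⁻ⁿ` over `[Kτ, ∞)`, which is at most
`3 (1 + ε cosh (Kτ))^{-(n-1)}` (`norm_smul_tsum_sub_sum_le`,
`integral_inv_one_add_mul_cosh_pow_le`). The last term of the bound alone therefore covers the
truncation error, and the middle one is slack.

*Admissible constants* (`exists_isAdmissible`). On `Ω_δ` one has `Re z ≤ δ - sin (α - d) |z|`. Near
the origin, `r(z) = e^z + o(z)`, and the linear decrease of `Re z` absorbs the remainder. Away from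
the origin and for small `δ`, the region lies in some half plane `Re z ≤ -η`, where `|r|` stays
below `1` by the maximum principle and `r = O(1/z)` because `𝒪` is invertible and `r(∞) = 0`.

*The maximum of `‖q‖`.* It is attained on `Ω_ρ` because `q(∞) = 0`. The argument `h γ(w)` lies in
`Ω_{hμ}`, which is not a subset of `Ω_ρ`: the part of it on the far side of the inner boundary
curve needs the maximum principle for `q` (`norm_qRow_le_of_mem`). The curves in question are
hyperbolas with foci `0` and `2μ`, so membership in these regions is an inequality between
distances (`mem_hypRegion_iff`).
-/

open MeasureTheory Filter Topology

/-! ### The trapezoidal rule for functions holomorphic in a strip -/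

section Strip

variable {X : Type*} [NormedAddCommGroup X] [NormedSpace ℂ X]

theorem ofReal_add_mul_I_mem_strip {d y : ℝ} (hy : |y| ≤ d) (x : ℝ) :
    (x : ℂ) + y * Complex.I ∈ strip d := by
  simpa [strip] using hy

theorem integrable_horizontal {f : ℂ → X} {d C y : ℝ}
    (hf : ∀ w ∈ strip d, DifferentiableAt ℂ f w)
    (hC : ∀ w ∈ strip d, ‖f w‖ ≤ C * (1 + w.re ^ 2)⁻¹) (hy : |y| ≤ d) :
    Integrable (fun x : ℝ => f (x + y * Complex.I)) := by
  refine (integrable_inv_one_add_sq.const_mul C).mono' ?_ ?_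
  · refine Continuous.aestronglyMeasurable (continuous_iff_continuousAt.2 fun x => ?_)
    have h := (hf _ (ofReal_add_mul_I_mem_strip hy x)).continuousAt
    exact ContinuousAt.comp (f := fun x : ℝ => (x : ℂ) + y * Complex.I) h (by fun_prop)
  · refine ae_of_all _ fun x => ?_
    simpa using hC _ (ofReal_add_mul_I_mem_strip hy x)

/-- Cauchy's theorem on long rectangles: the vertical sides contribute nothing in the limit. -/
theorem integral_horizontal_eq [CompleteSpace X] {f : ℂ → X} {d C y : ℝ}
    (hf : ∀ w ∈ strip d, DifferentiableAt ℂ f w)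
    (hC : ∀ w ∈ strip d, ‖f w‖ ≤ C * (1 + w.re ^ 2)⁻¹) (hy : |y| ≤ d) :
    ∫ x : ℝ, f (x + y * Complex.I) = ∫ x : ℝ, f x := by
  have h0 : |(0 : ℝ)| ≤ d := by simpa using (abs_nonneg y).trans hy
  have i1 := intervalIntegral_tendsto_integral (integrable_horizontal hf hC hy)
    tendsto_neg_atTop_atBot tendsto_id
  have i0 := intervalIntegral_tendsto_integral (integrable_horizontal hf hC h0)
    tendsto_neg_atTop_atBot tendsto_id
  have hsub : ∀ s ∈ Set.uIcc 0 y, |s| ≤ d := fun s hs => by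
    have := Set.abs_sub_left_of_mem_uIcc hs
    simp only [sub_zero] at this
    exact this.trans hy
  have hvert : ∀ s : ℝ → ℝ, (∀ T, s T ^ 2 = T ^ 2) →
      Tendsto (fun T : ℝ => ∫ v : ℝ in (0 : ℝ)..y, f (s T + v * Complex.I)) atTop (𝓝 0) := by
    intro s hs
    have hlim : Tendsto (fun T : ℝ => C * (1 + T ^ 2)⁻¹ * |y - 0|) atTop (𝓝 0) := by
      have : Tendsto (fun T : ℝ => (1 + T ^ 2)⁻¹) atTop (𝓝 0) :=
        (tendsto_atTop_add_const_left _ _ (tendsto_pow_atTop two_ne_zero)).inv_tendsto_atTop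
      simpa using (this.const_mul C).mul_const |y - 0|
    refine squeeze_zero_norm (fun T => ?_) hlim
    refine intervalIntegral.norm_integral_le_of_norm_le_const fun v hv => ?_
    have := hC _ (ofReal_add_mul_I_mem_strip (hsub v (Set.uIoc_subset_uIcc hv)) (s T))
    simpa [hs] using this
  have hr := hvert (fun T => T) fun T => rfl
  have hl := hvert (fun T => -T) fun T => by ring
  have key : ∀ T : ℝ, (∫ x : ℝ in -T..T, f (x + (0 : ℝ) * Complex.I))
      - (∫ x : ℝ in -T..T, f (x + y * Complex.I))
      + Complex.I • (∫ v : ℝ in (0 : ℝ)..y, f (T + v * Complex.I))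
      - Complex.I • (∫ v : ℝ in (0 : ℝ)..y, f ((-T : ℝ) + v * Complex.I)) = 0 := by
    intro T
    have := Complex.integral_boundary_rect_eq_zero_of_differentiableOn f
      ⟨-T, 0⟩ ⟨T, y⟩ (fun w hw => (hf w (hsub _ hw.2)).differentiableWithinAt)
    simpa using this
  have hlim := ((i0.sub i1).add (hr.const_smul Complex.I)).sub (hl.const_smul Complex.I)
  simp only [id] at hlim
  have := tendsto_nhds_unique (hlim.congr key) tendsto_const_nhds
  simp only [smul_zero, add_zero, sub_zero, sub_eq_zero] at this
  simpa using this.symm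

/-- Moving the line of integration to the boundary of the strip on which the character decays. -/
theorem norm_integral_mul_cexp_le {f : ℂ → ℂ} {d C : ℝ} (hd : 0 ≤ d)
    (hf : ∀ w ∈ strip d, DifferentiableAt ℂ f w)
    (hC : ∀ w ∈ strip d, ‖f w‖ ≤ C * (1 + w.re ^ 2)⁻¹) (ξ : ℝ) :
    ‖∫ x : ℝ, f x * Complex.exp (-(2 * Real.pi * ξ * x : ℝ) * Complex.I)‖ ≤
      C * Real.pi * Real.exp (-(2 * Real.pi * d * |ξ|)) := by
  set g : ℂ → ℂ := fun w => f w * Complex.exp (-((2 * Real.pi * ξ : ℝ) * w) * Complex.I) with hg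
  have hgd : ∀ w ∈ strip d, DifferentiableAt ℂ g w := fun w hw =>
    (hf w hw).mul (by fun_prop)
  have hnorm : ∀ w : ℂ, ‖g w‖ = ‖f w‖ * Real.exp (2 * Real.pi * ξ * w.im) := fun w => by
    simp [hg, Complex.norm_exp]
  have hgb : ∀ w ∈ strip d, ‖g w‖ ≤
      C * Real.exp (2 * Real.pi * d * |ξ|) * (1 + w.re ^ 2)⁻¹ := fun w hw => by
    rw [hnorm, mul_right_comm C]
    refine mul_le_mul (hC w hw) (Real.exp_le_exp.2 ?_) (Real.exp_pos _).le
      ((norm_nonneg _).trans (hC w hw))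
    calc 2 * Real.pi * ξ * w.im ≤ |2 * Real.pi * ξ * w.im| := le_abs_self _
      _ = 2 * Real.pi * (|ξ| * |w.im|) := by
        rw [mul_assoc, abs_mul (2 * Real.pi), abs_mul ξ, abs_of_pos Real.two_pi_pos]
      _ ≤ 2 * Real.pi * (|ξ| * d) := by
        have : |w.im| ≤ d := hw
        gcongr
      _ = _ := by ring
  -- the side of the strip on which `|e^{-2πiξw}|` is smallest
  obtain ⟨y, hy, hyξ⟩ : ∃ y : ℝ, |y| ≤ d ∧ ξ * y = -(d * |ξ|) := by
    rcases le_total 0 ξ with h | h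
    · exact ⟨-d, by simp [abs_of_nonneg hd], by rw [abs_of_nonneg h]; ring⟩
    · exact ⟨d, by simp [abs_of_nonneg hd], by rw [abs_of_nonpos h]; ring⟩
  have e1 : ∫ x : ℝ, f x * Complex.exp (-(2 * Real.pi * ξ * x : ℝ) * Complex.I) =
      ∫ x : ℝ, g (x + y * Complex.I) := by
    rw [integral_horizontal_eq hgd hgb hy]
    simp [hg]
  rw [e1]
  calc ‖∫ x : ℝ, g (x + y * Complex.I)‖
      ≤ ∫ x : ℝ, C * Real.exp (-(2 * Real.pi * d * |ξ|)) * (1 + x ^ 2)⁻¹ := by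
        refine norm_integral_le_of_norm_le (integrable_inv_one_add_sq.const_mul _) ?_
        refine ae_of_all _ fun x => ?_
        rw [hnorm, mul_right_comm C]
        have h1 : 2 * Real.pi * ξ * ((x : ℂ) + y * Complex.I).im = -(2 * Real.pi * d * |ξ|) := by
          have : ((x : ℂ) + y * Complex.I).im = y := by simp
          rw [this, mul_assoc, hyξ]; ring
        rw [h1]
        gcongr
        simpa using hC _ (ofReal_add_mul_I_mem_strip hy x)
    _ = _ := by rw [integral_const_mul, integral_univ_inv_one_add_sq]; ring

theorem summable_int_mul_of_bound {Y : Type*} [NormedAddCommGroup Y] [CompleteSpace Y]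
    {f : ℂ → Y} {d C τ : ℝ} (hd : 0 ≤ d) (hτ : 0 < τ)
    (hC : ∀ w ∈ strip d, ‖f w‖ ≤ C * (1 + w.re ^ 2)⁻¹) :
    Summable fun k : ℤ => f ((k * τ : ℝ) : ℂ) := by
  have hC0 : 0 ≤ C := by
    have := (norm_nonneg _).trans (hC 0 (by simpa [strip] using hd))
    simpa using this
  have hs : Summable fun k : ℤ => C * (τ ^ 2)⁻¹ * ((k : ℝ) ^ 2)⁻¹ := by
    refine Summable.mul_left _ ?_
    exact_mod_cast (Real.summable_one_div_int_pow (p := 2)).2 one_lt_two |>.congr fun k => by simp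
  refine Summable.of_norm_bounded_eventually hs ?_
  filter_upwards [eventually_cofinite_ne (0 : ℤ)] with k hk
  have hk' : (0 : ℝ) < (k : ℝ) ^ 2 := by positivity
  have := hC ((k * τ : ℝ) : ℂ) (by simpa [strip] using hd)
  refine this.trans ?_
  rw [Complex.ofReal_re, mul_assoc, ← mul_inv]
  gcongr
  nlinarith

open FourierTransform in
/-- Poisson summation: the error is the sum of the Fourier coefficients at the nonzero multiples of
`1 / τ`, two geometric series. -/
theorem norm_integral_sub_tsum_le_scalar {f : ℂ → ℂ} {d C τ : ℝ} (hd : 0 < d) (hτ : 0 < τ)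
    (hf : ∀ w ∈ strip d, DifferentiableAt ℂ f w)
    (hC : ∀ w ∈ strip d, ‖f w‖ ≤ C * (1 + w.re ^ 2)⁻¹) :
    ‖(∫ x : ℝ, f x) - τ * ∑' k : ℤ, f ((k * τ : ℝ) : ℂ)‖ ≤
      2 * (C * Real.pi) / (Real.exp (2 * Real.pi * d / τ) - 1) := by
  set F : ℝ → ℂ := fun x => f ((x * τ : ℝ) : ℂ) with hF
  have hC0 : 0 ≤ C := by
    have := (norm_nonneg _).trans (hC 0 (by simpa [strip] using hd.le))
    simpa using this
  have hmem : ∀ x : ℝ, (x : ℂ) ∈ strip d := fun x => by simpa [strip] using hd.le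
  have hFc : Continuous F := by
    refine continuous_iff_continuousAt.2 fun x => ?_
    exact ContinuousAt.comp (f := fun x : ℝ => ((x * τ : ℝ) : ℂ)) (hf _ (hmem _)).continuousAt
      (by fun_prop)
  have hFO : F =O[cocompact ℝ] fun x : ℝ => |x| ^ (-2 : ℝ) := by
    refine Asymptotics.IsBigO.of_bound (C * (τ ^ 2)⁻¹) ?_
    have : ∀ᶠ x : ℝ in cocompact ℝ, x ≠ 0 := by
      have := (isCompact_singleton (x := (0 : ℝ))).compl_mem_cocompact
      filter_upwards [this] with x hx using hx
    filter_upwards [this] with x hx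
    have h2 : |x| ^ (-2 : ℝ) = (x ^ 2)⁻¹ := by
      rw [Real.rpow_neg (abs_nonneg x)]; norm_cast; rw [sq_abs]
    rw [h2, norm_inv, Real.norm_of_nonneg (sq_nonneg x)]
    refine (hC _ (hmem _)).trans ?_
    have hx2 : 0 < x ^ 2 := by positivity
    rw [Complex.ofReal_re, mul_assoc, ← mul_inv]
    gcongr
    nlinarith
  have hFj : ∀ j : ℤ, 𝓕 F j =
      (τ⁻¹ : ℝ) • ∫ x : ℝ, f x * Complex.exp (-(2 * Real.pi * (j / τ) * x : ℝ) * Complex.I) := by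
    intro j
    rw [Real.fourier_real_eq_integral_exp_smul]
    have := Measure.integral_comp_mul_right
      (fun x : ℝ => f x * Complex.exp (-(2 * Real.pi * (j / τ) * x : ℝ) * Complex.I)) τ
    rw [abs_of_pos (inv_pos.2 hτ)] at this
    rw [← this]
    congr 1
    ext x
    rw [smul_eq_mul, mul_comm]
    congr 3
    have hτ' : (τ : ℂ) ≠ 0 := by exact_mod_cast hτ.ne'
    push_cast
    field_simp
  set r : ℝ := Real.exp (-(2 * Real.pi * d / τ)) with hr
  have hr0 : 0 < r := Real.exp_pos _
  have hr1 : r < 1 := by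
    rw [hr, Real.exp_lt_one_iff]
    have := Real.pi_pos
    have : 0 < 2 * Real.pi * d / τ := by positivity
    linarith
  have hFb : ∀ j : ℤ, ‖𝓕 F j‖ ≤ τ⁻¹ * (C * Real.pi) * r ^ j.natAbs := by
    intro j
    rw [hFj, norm_smul, Real.norm_of_nonneg (inv_pos.2 hτ).le, mul_assoc τ⁻¹]
    refine mul_le_mul_of_nonneg_left ?_ (inv_pos.2 hτ).le
    refine (norm_integral_mul_cexp_le hd.le hf hC (j / τ)).trans_eq ?_
    rw [hr, ← Real.exp_nat_mul, Nat.cast_natAbs, abs_div, abs_of_pos hτ, Int.cast_abs]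
    congr 2
    ring
  have hgeo := hasSum_geometric_of_lt_one hr0.le hr1
  have hsum : Summable fun j : ℤ => 𝓕 F j := by
    refine Summable.of_norm_bounded (g := fun j : ℤ => τ⁻¹ * (C * Real.pi) * r ^ j.natAbs) ?_ hFb
    refine Summable.mul_left _ (Summable.of_nat_of_neg ?_ ?_)
    · simpa using hgeo.summable
    · simpa using hgeo.summable
  have hP := Real.tsum_eq_tsum_fourier_of_rpow_decay_of_summable hFc one_lt_two hFO hsum 0
  simp only [zero_add, QuotientAddGroup.mk_zero, fourier_eval_zero, mul_one] at hP
  have hsp : ∑' j : ℤ, 𝓕 F j = 𝓕 F (0 : ℤ) + ∑' j : ℕ, 𝓕 F ((j + 1 : ℕ) : ℤ)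
      + ∑' j : ℕ, 𝓕 F (-(j + 1 : ℕ) : ℤ) := by
    have hnat : Summable fun j : ℕ => 𝓕 F (j : ℤ) := hsum.comp_injective Nat.cast_injective
    have hneg : Summable fun j : ℕ => 𝓕 F ((-((j : ℤ) + 1) : ℤ) : ℝ) :=
      hsum.comp_injective (i := fun j : ℕ => -((j : ℤ) + 1)) fun a b h => by simpa using h
    have := tsum_of_nat_of_neg_add_one (f := fun j : ℤ => 𝓕 F (j : ℝ)) hnat hneg
    rw [this, hnat.tsum_eq_zero_add]
    simp
  have hbd := ((hgeo.mul_left r).mul_left (τ⁻¹ * (C * Real.pi)))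
  have hb1 : ‖∑' j : ℕ, 𝓕 F ((j + 1 : ℕ) : ℤ)‖ ≤ τ⁻¹ * (C * Real.pi) * (r * (1 - r)⁻¹) := by
    refine tsum_of_norm_bounded hbd fun j => ?_
    have := hFb ((j + 1 : ℕ) : ℤ)
    rwa [Int.natAbs_natCast, pow_succ'] at this
  have hb2 : ‖∑' j : ℕ, 𝓕 F (-(j + 1 : ℕ) : ℤ)‖ ≤ τ⁻¹ * (C * Real.pi) * (r * (1 - r)⁻¹) := by
    refine tsum_of_norm_bounded hbd fun j => ?_
    have := hFb (-(j + 1 : ℕ) : ℤ)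
    rwa [Int.natAbs_neg, Int.natAbs_natCast, pow_succ'] at this
  have h0 : (τ : ℂ) * 𝓕 F (0 : ℤ) = ∫ x : ℝ, f x := by
    rw [hFj]
    have hτ' : (τ : ℂ) ≠ 0 := by exact_mod_cast hτ.ne'
    simp [hτ']
  have hrr : r * (1 - r)⁻¹ = (Real.exp (2 * Real.pi * d / τ) - 1)⁻¹ := by
    have he : Real.exp (2 * Real.pi * d / τ) = r⁻¹ := by rw [hr, Real.exp_neg, inv_inv]
    rw [he, ← div_eq_mul_inv, ← inv_div]
    congr 1
    field_simp
  have hfin : (∫ x : ℝ, f x) - τ * ∑' k : ℤ, f ((k * τ : ℝ) : ℂ) =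
      -(τ * (∑' j : ℕ, 𝓕 F ((j + 1 : ℕ) : ℤ) + ∑' j : ℕ, 𝓕 F (-(j + 1 : ℕ) : ℤ))) := by
    have hP' : ∑' k : ℤ, f ((k * τ : ℝ) : ℂ) = ∑' j : ℤ, 𝓕 F j := hP
    rw [hP', hsp, ← h0]
    ring
  rw [hfin, norm_neg, norm_mul, Complex.norm_real, Real.norm_of_nonneg hτ.le]
  calc τ * ‖_‖ ≤ τ * (τ⁻¹ * (C * Real.pi) * (r * (1 - r)⁻¹)
        + τ⁻¹ * (C * Real.pi) * (r * (1 - r)⁻¹)) := by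
        gcongr
        exact (norm_add_le _ _).trans (add_le_add hb1 hb2)
    _ = _ := by
        rw [hrr]
        field_simp
        ring

/-- Exponential convergence of the trapezoidal rule for vector-valued functions: testing with
continuous linear functionals reduces it to the scalar case. -/
theorem norm_integral_sub_tsum_le [CompleteSpace X] {f : ℂ → X} {d C τ : ℝ} (hd : 0 < d)
    (hτ : 0 < τ) (hf : ∀ w ∈ strip d, DifferentiableAt ℂ f w)
    (hC : ∀ w ∈ strip d, ‖f w‖ ≤ C * (1 + w.re ^ 2)⁻¹) :
    ‖(∫ x : ℝ, f x) - τ • ∑' k : ℤ, f ((k * τ : ℝ) : ℂ)‖ ≤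
      2 * (C * Real.pi) / (Real.exp (2 * Real.pi * d / τ) - 1) := by
  have hC0 : 0 ≤ C := by
    have := (norm_nonneg _).trans (hC 0 (by simpa [strip] using hd.le))
    simpa using this
  have hexp : 0 < Real.exp (2 * Real.pi * d / τ) - 1 := by
    have := Real.pi_pos
    rw [sub_pos, Real.one_lt_exp_iff]
    positivity
  refine NormedSpace.norm_le_dual_bound ℂ _ (by have := Real.pi_pos; positivity) fun l => ?_
  have hi : Integrable (fun x : ℝ => f x) := by
    simpa using integrable_horizontal hf hC (y := 0) (by simpa using hd.le)
  have e : l ((∫ x : ℝ, f x) - τ • ∑' k : ℤ, f ((k * τ : ℝ) : ℂ)) =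
      (∫ x : ℝ, l (f x)) - τ * ∑' k : ℤ, l (f ((k * τ : ℝ) : ℂ)) := by
    rw [map_sub, ← l.integral_comp_comm hi, ← Complex.coe_smul, map_smul,
      l.map_tsum (summable_int_mul_of_bound hd.le hτ hC), smul_eq_mul]
  rw [e]
  refine (norm_integral_sub_tsum_le_scalar (f := fun w => l (f w)) (C := ‖l‖ * C) hd hτ
    (fun w hw => l.differentiableAt.comp w (hf w hw)) fun w hw => ?_).trans_eq (by ring)
  rw [mul_assoc]
  exact (l.le_opNorm _).trans (mul_le_mul_of_nonneg_left (hC w hw) (norm_nonneg _))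

end Strip

/-! ### Truncation of the trapezoidal sum -/

theorem sum_Icc_neg_eq_sum_range_add {X : Type*} [AddCommGroup X] (f : ℤ → X) (K : ℕ) :
    ∑ k ∈ Finset.Icc (-(K : ℤ)) K, f k =
      ∑ i ∈ Finset.range (K + 1), f i + ∑ i ∈ Finset.range K, f (-((i : ℤ) + 1)) := by
  induction K with
  | zero => simp
  | succ K ih =>
    push_cast
    rw [Finset.sum_Icc_succ_eq_add_endpoints, ih, Finset.sum_range_succ _ (K + 1),
      Finset.sum_range_succ (fun i : ℕ => f (-((i : ℤ) + 1))) K]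
    push_cast
    abel

/-- The neglected terms of a truncated trapezoidal sum, compared with the tail integrals of a
decreasing majorant. -/
theorem norm_smul_tsum_sub_sum_le {X : Type*} [NormedAddCommGroup X] [NormedSpace ℝ X]
    [CompleteSpace X] {G : ℝ → X} {g : ℝ → ℝ} {τ B : ℝ} {K : ℕ} (hτ : 0 < τ)
    (hs : Summable fun k : ℤ => G (k * τ)) (hg : ∀ x, ‖G x‖ ≤ g |x|)
    (hanti : AntitoneOn g (Set.Ici (K * τ)))
    (hB : ∀ Y, K * τ ≤ Y → ∫ x in (K * τ)..Y, g x ≤ B) :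
    ‖τ • (∑' k : ℤ, G (k * τ) - ∑ k ∈ Finset.Icc (-(K : ℤ)) K, G (k * τ))‖ ≤ 2 * B := by
  set f : ℤ → X := fun k => G (k * τ) with hf
  have hpart : ∀ N : ℕ, ∑ i ∈ Finset.range N, τ * g ((i + K + 1 : ℕ) * τ) ≤ B := by
    intro N
    have ha : AntitoneOn (fun x => g (x * τ)) (Set.Icc (K : ℝ) (K + N)) := by
      intro x hx y hy hxy
      have h1 : K * τ ≤ x * τ := mul_le_mul_of_nonneg_right hx.1 hτ.le
      have h2 : x * τ ≤ y * τ := mul_le_mul_of_nonneg_right hxy hτ.le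
      exact hanti h1 (h1.trans h2) h2
    have h := ha.sum_le_integral
    rw [intervalIntegral.integral_comp_mul_right _ hτ.ne', smul_eq_mul, inv_mul_eq_div,
      le_div_iff₀ hτ, mul_comm, Finset.mul_sum] at h
    refine le_trans (le_of_eq ?_) (h.trans (hB _ ?_))
    · refine Finset.sum_congr rfl fun i _ => ?_
      push_cast
      ring_nf
    · gcongr
      linarith [Nat.cast_nonneg (α := ℝ) N]
  have htail : ∀ u : ℕ → X, (∀ i, ‖u i‖ ≤ g ((i + K + 1 : ℕ) * τ)) → ‖τ • ∑' i, u i‖ ≤ B := by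
    intro u hu
    have hnn : ∀ i : ℕ, 0 ≤ τ * g ((i + K + 1 : ℕ) * τ) := fun i =>
      mul_nonneg hτ.le ((norm_nonneg _).trans (hu i))
    have hsum := summable_of_sum_range_le hnn hpart
    rw [← tsum_const_smul'']
    refine (tsum_of_norm_bounded hsum.hasSum fun i => ?_).trans
      (hsum.tsum_le_of_sum_range_le hpart)
    rw [norm_smul, Real.norm_of_nonneg hτ.le]
    exact mul_le_mul_of_nonneg_left (hu i) hτ.le
  have hnat : Summable fun j : ℕ => f j := hs.comp_injective Nat.cast_injective
  have hneg : Summable fun j : ℕ => f (-((j : ℤ) + 1)) :=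
    hs.comp_injective (i := fun j : ℕ => -((j : ℤ) + 1)) fun a b h => by simpa using h
  have hsplit : ∑' k : ℤ, f k - ∑ k ∈ Finset.Icc (-(K : ℤ)) K, f k =
      ∑' i : ℕ, f ((i + (K + 1) : ℕ) : ℤ) + ∑' i : ℕ, f (-(((i + K : ℕ) : ℤ) + 1)) := by
    rw [tsum_of_nat_of_neg_add_one hnat hneg, sum_Icc_neg_eq_sum_range_add,
      ← hnat.sum_add_tsum_nat_add (K + 1), ← hneg.sum_add_tsum_nat_add K]
    abel
  rw [hsplit, smul_add, two_mul]
  refine (norm_add_le _ _).trans (add_le_add (htail _ fun i => ?_) (htail _ fun i => ?_))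
  · refine (hg _).trans_eq ?_
    congr 1
    rw [abs_of_nonneg (by positivity)]
    push_cast
    ring
  · refine (hg _).trans_eq ?_
    congr 1
    rw [abs_mul, abs_of_pos hτ, Int.cast_neg, abs_neg, abs_of_nonneg (by positivity)]
    push_cast
    ring

/-! ### Geometry of the hyperbola -/

section Hyperbola

theorem hyperbola_re (α μ : ℝ) (w : ℂ) :
    (hyperbola α μ w).re = μ * (1 - Real.sin (α - w.im) * Real.cosh w.re) := by
  have : (α : ℂ) + Complex.I * w = ((α - w.im : ℝ) : ℂ) + (w.re : ℝ) * Complex.I := by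
    apply Complex.ext <;> simp [sub_eq_add_neg]
  rw [hyperbola, this, Complex.sin_add_mul_I, ← Complex.ofReal_sin, ← Complex.ofReal_cos,
    ← Complex.ofReal_cosh, ← Complex.ofReal_sinh]
  simp only [Complex.sub_re, Complex.sub_im, Complex.add_re, Complex.add_im, Complex.mul_re,
    Complex.mul_im, Complex.ofReal_re, Complex.ofReal_im, Complex.I_re, Complex.I_im,
    Complex.one_re, Complex.one_im]
  ring

theorem hyperbola_im (α μ : ℝ) (w : ℂ) :
    (hyperbola α μ w).im = -(μ * (Real.cos (α - w.im) * Real.sinh w.re)) := by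
  have : (α : ℂ) + Complex.I * w = ((α - w.im : ℝ) : ℂ) + (w.re : ℝ) * Complex.I := by
    apply Complex.ext <;> simp [sub_eq_add_neg]
  rw [hyperbola, this, Complex.sin_add_mul_I, ← Complex.ofReal_sin, ← Complex.ofReal_cos,
    ← Complex.ofReal_cosh, ← Complex.ofReal_sinh]
  simp only [Complex.sub_re, Complex.sub_im, Complex.add_re, Complex.add_im, Complex.mul_re,
    Complex.mul_im, Complex.ofReal_re, Complex.ofReal_im, Complex.I_re, Complex.I_im,
    Complex.one_re, Complex.one_im]
  ring

theorem norm_hyperbola (α : ℝ) {μ : ℝ} (hμ : 0 ≤ μ) (w : ℂ) :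
    ‖hyperbola α μ w‖ = μ * (Real.cosh w.re - Real.sin (α - w.im)) := by
  have h1 := Real.one_le_cosh w.re
  have h2 := Real.sin_le_one (α - w.im)
  rw [Complex.norm_eq_sqrt_sq_add_sq, hyperbola_re, hyperbola_im,
    Real.sqrt_eq_iff_mul_self_eq (by positivity) (mul_nonneg hμ (by linarith))]
  have h3 := Real.sin_sq_add_cos_sq (α - w.im)
  have h4 := Real.cosh_sq w.re
  have h5 : Real.cos (α - w.im) ^ 2 = 1 - Real.sin (α - w.im) ^ 2 := by linarith
  have h6 : Real.sinh w.re ^ 2 = Real.cosh w.re ^ 2 - 1 := by linarith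
  rw [neg_sq, mul_pow, mul_pow, mul_pow, h5, h6]
  ring

theorem hasDerivAt_hyperbola (α μ : ℝ) (w : ℂ) :
    HasDerivAt (hyperbola α μ) (-(μ * Complex.cos (α + Complex.I * w) * Complex.I)) w := by
  have h : HasDerivAt (fun w : ℂ => (α : ℂ) + Complex.I * w) Complex.I w := by
    simpa using ((hasDerivAt_id w).const_mul Complex.I).const_add (α : ℂ)
  have := ((h.csin).const_sub 1).const_mul (μ : ℂ)
  convert! this using 1
  ring

theorem norm_deriv_hyperbola_sq (α μ : ℝ) (w : ℂ) :
    ‖deriv (hyperbola α μ) w‖ ^ 2 =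
      μ ^ 2 * (Real.cosh w.re ^ 2 - Real.sin (α - w.im) ^ 2) := by
  have : (α : ℂ) + Complex.I * w = ((α - w.im : ℝ) : ℂ) + (w.re : ℝ) * Complex.I := by
    apply Complex.ext <;> simp [sub_eq_add_neg]
  rw [(hasDerivAt_hyperbola α μ w).deriv, norm_neg, norm_mul, norm_mul, Complex.norm_I, mul_one,
    mul_pow, Complex.norm_real, Real.norm_eq_abs, sq_abs, this, Complex.cos_add_mul_I,
    ← Complex.ofReal_sin, ← Complex.ofReal_cos, ← Complex.ofReal_cosh, ← Complex.ofReal_sinh,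
    ← Complex.ofReal_mul, ← Complex.ofReal_mul, Complex.sq_norm, Complex.normSq_apply]
  congr 1
  have h3 := Real.sin_sq_add_cos_sq (α - w.im)
  have h4 := Real.cosh_sq w.re
  have h5 : Real.cos (α - w.im) ^ 2 = 1 - Real.sin (α - w.im) ^ 2 := by linarith
  have h6 : Real.sinh w.re ^ 2 = Real.cosh w.re ^ 2 - 1 := by linarith
  simp only [Complex.sub_re, Complex.sub_im, Complex.mul_re, Complex.mul_im, Complex.ofReal_re,
    Complex.ofReal_im, Complex.I_re, Complex.I_im]
  ring_nf
  rw [h5, h6]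
  ring

theorem ofReal_mul_hyperbola (α μ h : ℝ) (w : ℂ) :
    (h : ℂ) * hyperbola α μ w = hyperbola α (h * μ) w := by
  simp [hyperbola, mul_assoc]

variable {α d : ℝ} {w : ℂ}

theorem sin_le_sin_of_mem_strip (hαd : 0 < α - d) (hαd' : α + d < Real.pi / 2)
    (hw : w ∈ strip d) :
    Real.sin (α - d) ≤ Real.sin (α - w.im) ∧ Real.sin (α - w.im) ≤ Real.sin (α + d) := by
  have := abs_le.1 (show |w.im| ≤ d from hw)
  constructor <;> apply Real.sin_le_sin_of_le_of_le_pi_div_two <;> linarith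

theorem sin_add_mem_Ioo (hd : 0 < d) (hαd : 0 < α - d) (hαd' : α + d < Real.pi / 2) :
    Real.sin (α + d) ∈ Set.Ioo 0 1 := by
  refine ⟨Real.sin_pos_of_pos_of_lt_pi (by linarith) (by linarith), ?_⟩
  rw [← Real.sin_pi_div_two]
  exact Real.sin_lt_sin_of_lt_of_le_pi_div_two (by linarith) le_rfl hαd'

theorem hyperbola_ne_zero (hd : 0 < d) (hαd : 0 < α - d) (hαd' : α + d < Real.pi / 2) {μ : ℝ}
    (hμ : 0 < μ) (hw : w ∈ strip d) : hyperbola α μ w ≠ 0 := by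
  rw [← norm_pos_iff, norm_hyperbola α hμ.le]
  have h1 := Real.one_le_cosh w.re
  have h2 := (sin_le_sin_of_mem_strip hαd hαd' hw).2
  have h3 := (sin_add_mem_Ioo hd hαd hαd').2
  exact mul_pos hμ (by linarith)

/-- `|γ'| / |γ| = √((cosh x + s) / (cosh x - s))` is largest at `x = 0`. -/
theorem norm_deriv_hyperbola_le (hd : 0 < d) (hαd : 0 < α - d) (hαd' : α + d < Real.pi / 2)
    {μ : ℝ} (hμ : 0 < μ) (hw : w ∈ strip d) :
    ‖deriv (hyperbola α μ) w‖ ≤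
      √((1 + Real.sin (α + d)) / (1 - Real.sin (α + d))) * ‖hyperbola α μ w‖ := by
  have h1 := Real.one_le_cosh w.re
  obtain ⟨h2, h3⟩ := sin_le_sin_of_mem_strip hαd hαd' hw
  obtain ⟨h4, h5⟩ := sin_add_mem_Ioo hd hαd hαd'
  have hq : 0 ≤ (1 + Real.sin (α + d)) / (1 - Real.sin (α + d)) :=
    div_nonneg (by linarith) (by linarith)
  refine abs_le_of_sq_le_sq' ?_ (by positivity) |>.2
  rw [norm_deriv_hyperbola_sq, mul_pow, Real.sq_sqrt hq, norm_hyperbola α hμ.le, mul_pow,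
    div_mul_eq_mul_div, le_div_iff₀ (by linarith)]
  have hcs : 0 ≤ Real.cosh w.re - Real.sin (α - w.im) := by linarith
  have key : (Real.cosh w.re + Real.sin (α - w.im)) * (1 - Real.sin (α + d)) ≤
      (1 + Real.sin (α + d)) * (Real.cosh w.re - Real.sin (α - w.im)) := by nlinarith
  have := mul_le_mul_of_nonneg_left key (mul_nonneg (sq_nonneg μ) hcs)
  nlinarith

/-- The hyperbola stays inside the sector because `Re γ ≥ -cos φ |γ|`. -/
theorem abs_arg_hyperbola_le {φ : ℝ} (hd : 0 < d) (hφ₀ : 0 ≤ φ) (hαd : 0 < α - d)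
    (hαd' : α + d < Real.pi / 2 - φ) {μ : ℝ} (hμ : 0 < μ) (hw : w ∈ strip d) :
    |(hyperbola α μ w).arg| ≤ Real.pi - φ := by
  have hαd'' : α + d < Real.pi / 2 := by linarith
  have h0 := hyperbola_ne_zero hd hαd hαd'' hμ hw
  by_contra! hlt
  have hcos := Real.cos_lt_cos_of_nonneg_of_le_pi (by linarith) (Complex.abs_arg_le_pi _) hlt
  rw [Real.cos_abs, Complex.cos_arg h0, Real.cos_pi_sub, div_lt_iff₀ (norm_pos_iff.2 h0),
    norm_hyperbola α hμ.le, hyperbola_re] at hcos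
  have h1 := Real.one_le_cosh w.re
  have h2 := (sin_le_sin_of_mem_strip hαd hαd'' hw).2
  have h3 : Real.sin (α + d) ≤ Real.cos φ := by
    rw [← Real.sin_pi_div_two_sub]
    exact Real.sin_le_sin_of_le_of_le_pi_div_two (by linarith) (by linarith) hαd'.le
  have h4 := Real.cos_le_one φ
  have h5 := Real.sin_le_one (α - w.im)
  have h6 : 0 ≤ Real.sin (α - w.im) := by
    have := abs_le.1 (show |w.im| ≤ d from hw)
    exact Real.sin_nonneg_of_nonneg_of_le_pi (by linarith) (by linarith)
  -- `1 - s c + cos φ (c - s) = (1 - s cos φ) + c (cos φ - s)` with both summands nonnegative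
  have h7 : 0 ≤ 1 - Real.sin (α - w.im) * Real.cosh w.re
      + Real.cos φ * (Real.cosh w.re - Real.sin (α - w.im)) := by nlinarith
  nlinarith [mul_nonneg hμ.le h7]

/-- On the region the real part is bounded by `δ` and decreases linearly in `|z|`. -/
theorem re_le_of_mem_hypRegion {δ : ℝ} (hd : 0 < d) (hαd : 0 < α - d)
    (hαd' : α + d < Real.pi / 2) (hδ : 0 < δ) {z : ℂ} (hz : z ∈ hypRegion α d δ) :
    z.re ≤ δ - Real.sin (α - d) * ‖z‖ := by
  obtain ⟨w, hw, rfl⟩ := hz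
  rw [norm_hyperbola α hδ.le, hyperbola_re]
  have h1 := Real.one_le_cosh w.re
  obtain ⟨h2, h3⟩ := sin_le_sin_of_mem_strip hαd hαd' hw
  obtain ⟨h4, h5⟩ := sin_add_mem_Ioo hd hαd hαd'
  have h6 : 0 < Real.sin (α - d) := Real.sin_pos_of_pos_of_lt_pi hαd (by linarith)
  have : Real.sin (α - d) * (Real.cosh w.re - Real.sin (α - w.im)) ≤
      Real.sin (α - w.im) * Real.cosh w.re := by nlinarith
  nlinarith [mul_le_mul_of_nonneg_left this hδ.le]

end Hyperbola

/-! ### The stability function and the row vector `q` -/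

/-- A nonnegative continuous function that vanishes at infinity attains its maximum on a closed
set, also when it vanishes identically. -/
theorem exists_isMaxOn_of_tendsto_zero {β : Type*} [TopologicalSpace β] {s : Set β} {f : β → ℝ}
    (hs : IsClosed s) (hne : s.Nonempty) (hf : ContinuousOn f s) (h0 : ∀ x ∈ s, 0 ≤ f x)
    (hlim : Tendsto f (cocompact β ⊓ 𝓟 s) (𝓝 0)) : ∃ x ∈ s, IsMaxOn f s x := by
  by_cases h : ∃ x ∈ s, 0 < f x
  · obtain ⟨x, hx, hpos⟩ := h
    exact hf.exists_isMaxOn' hs hx ((hlim.eventually_lt_const hpos).mono fun _ h => h.le)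
  · push Not at h
    obtain ⟨x, hx⟩ := hne
    exact ⟨x, hx, fun y hy => (h y hy).trans (h0 x hx)⟩

namespace RKMethod

variable {m : ℕ} (R : RKMethod m)

-- A submultiplicative norm on matrices, needed only to differentiate the inverse.
attribute [local instance] Matrix.linftyOpNormedAddCommGroup Matrix.linftyOpNormedRing
  Matrix.linftyOpNormedAlgebra

theorem differentiableAt_matrix_inv {M : ℂ → Matrix (Fin m) (Fin m) ℂ} {z : ℂ}
    (hM : DifferentiableAt ℂ M z) (hz : (M z).det ≠ 0) :
    DifferentiableAt ℂ (fun z => (M z)⁻¹) z := by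
  have : CompleteSpace (Matrix (Fin m) (Fin m) ℂ) := FiniteDimensional.complete ℂ _
  have hu : IsUnit (M z) := (Matrix.isUnit_iff_isUnit_det _).2 hz.isUnit
  simp only [Matrix.nonsing_inv_eq_ringInverse]
  exact DifferentiableAt.fun_comp' z (g := Ring.inverse) (differentiableAt_inverse hu) hM

theorem differentiableAt_vecMul_inv {M : ℂ → Matrix (Fin m) (Fin m) ℂ} {z : ℂ}
    (hM : DifferentiableAt ℂ M z) (hz : (M z).det ≠ 0) (v : Fin m → ℂ) :
    DifferentiableAt ℂ (fun z => Matrix.vecMul v (M z)⁻¹) z :=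
  (LinearMap.toContinuousLinearMap
    (Matrix.vecMulBilin ℂ ℂ v :
      Matrix (Fin m) (Fin m) ℂ →ₗ[ℂ] (Fin m → ℂ))).differentiableAt.comp z
    (differentiableAt_matrix_inv hM hz)

theorem differentiableAt_q {z : ℂ} (hz : (1 - z • R.aC).det ≠ 0) : DifferentiableAt ℂ R.q z :=
  differentiableAt_vecMul_inv (M := fun z => 1 - z • R.aC) (by fun_prop) hz _

theorem differentiableAt_dotProduct_one {f : ℂ → Fin m → ℂ} {z : ℂ} (hf : DifferentiableAt ℂ f z) :
    DifferentiableAt ℂ (fun z => f z ⬝ᵥ fun _ => 1) z := by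
  simp only [dotProduct, mul_one]
  rw [differentiableAt_pi] at hf
  fun_prop

theorem differentiableAt_r {z : ℂ} (hz : (1 - z • R.aC).det ≠ 0) : DifferentiableAt ℂ R.r z := by
  have := differentiableAt_dotProduct_one (R.differentiableAt_q hz)
  exact (differentiableAt_const _).add (differentiableAt_id.mul this)

theorem differentiableAt_qRow (p : ℝ≥0∞) [Fact (1 ≤ p)] {z : ℂ} (hz : (1 - z • R.aC).det ≠ 0) :
    DifferentiableAt ℂ (R.qRow p) z := by
  have h := differentiableAt_pi.1 (R.differentiableAt_q hz)
  exact DifferentiableAt.fun_sum fun i _ => (h i).smul_const _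

theorem r_zero : R.r 0 = 1 := by simp [r]

variable {R}

/-- A pole `z` of the resolvent is the inverse of an eigenvalue. -/
theorem det_ne_zero_of_re_nonpos (hspec : ∀ z ∈ spectrum ℂ R.aC, 0 < z.re) {z : ℂ}
    (hz : z.re ≤ 0) : (1 - z • R.aC).det ≠ 0 := by
  rcases eq_or_ne z 0 with rfl | h0
  · simp
  intro hdet
  have hmem : z⁻¹ ∈ spectrum ℂ R.aC := by
    rw [spectrum.mem_iff]
    intro hu
    have e : algebraMap ℂ (Matrix (Fin m) (Fin m) ℂ) z⁻¹ - R.aC = z⁻¹ • (1 - z • R.aC) := by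
      rw [smul_sub, smul_smul, inv_mul_cancel₀ h0, one_smul, Algebra.algebraMap_eq_smul_one]
    rw [e, Matrix.isUnit_iff_isUnit_det, Matrix.det_smul, hdet, mul_zero] at hu
    exact not_isUnit_zero hu
  have := hspec _ hmem
  rw [Complex.inv_re] at this
  exact this.not_ge (div_nonpos_of_nonpos_of_nonneg hz (Complex.normSq_nonneg z))

theorem det_aC_ne_zero (hspec : ∀ z ∈ spectrum ℂ R.aC, 0 < z.re) : R.aC.det ≠ 0 := by
  intro hdet
  have : (0 : ℂ) ∈ spectrum ℂ R.aC := by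
    rw [spectrum.mem_iff, map_zero, zero_sub, IsUnit.neg_iff, Matrix.isUnit_iff_isUnit_det, hdet]
    exact not_isUnit_zero
  simpa using hspec _ this

/-- The chart `u = 1 / z` at infinity, in which the resolvent is `(𝒪 - u)⁻¹`. -/
theorem q_inv {u : ℂ} (hu : u ≠ 0) :
    R.q u⁻¹ = -u • Matrix.vecMul R.bC (R.aC - u • 1)⁻¹ := by
  have e : (1 - u⁻¹ • R.aC) = (-u⁻¹) • (R.aC - u • 1) := by
    rw [smul_sub, smul_smul, neg_mul, inv_mul_cancel₀ hu, neg_smul, neg_smul, one_smul]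
    abel
  rw [q, e]
  by_cases h : IsUnit (R.aC - u • 1).det
  · have : ((-u⁻¹) • (R.aC - u • 1))⁻¹ = -u • (R.aC - u • 1)⁻¹ := by
      apply Matrix.inv_eq_left_inv
      rw [smul_mul_smul_comm, Matrix.nonsing_inv_mul _ h]
      simp [hu]
    rw [this, Matrix.vecMul_smul]
  · have h' : ¬ IsUnit ((-u⁻¹) • (R.aC - u • 1)).det := by
      rw [Matrix.det_smul, isUnit_iff_ne_zero, not_not]
      rw [isUnit_iff_ne_zero, not_not] at h
      rw [h, mul_zero]
    rw [Matrix.nonsing_inv_apply_not_isUnit _ h, Matrix.nonsing_inv_apply_not_isUnit _ h']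
    simp

theorem differentiableAt_vecMul_infty (hspec : ∀ z ∈ spectrum ℂ R.aC, 0 < z.re) :
    DifferentiableAt ℂ (fun u : ℂ => Matrix.vecMul R.bC (R.aC - u • 1)⁻¹) 0 :=
  differentiableAt_vecMul_inv (M := fun u => R.aC - u • 1) (by fun_prop)
    (by simpa using det_aC_ne_zero hspec) _

theorem tendsto_inv_cocompact : Tendsto (fun z : ℂ => z⁻¹) (cocompact ℂ) (𝓝[≠] 0) := by
  rw [← Metric.cobounded_eq_cocompact]
  exact Filter.tendsto_inv₀_cobounded'

theorem tendsto_q_cocompact (hspec : ∀ z ∈ spectrum ℂ R.aC, 0 < z.re) :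
    Tendsto R.q (cocompact ℂ) (𝓝 0) := by
  have h : Tendsto (fun u : ℂ => -u • Matrix.vecMul R.bC (R.aC - u • 1)⁻¹) (𝓝 0) (𝓝 0) := by
    have := (continuous_neg.tendsto (0 : ℂ)).smul
      (differentiableAt_vecMul_infty hspec).continuousAt.tendsto
    simpa using this
  have h2 := h.comp (tendsto_inv_cocompact.mono_right nhdsWithin_le_nhds)
  refine h2.congr' ?_
  filter_upwards [tendsto_inv_cocompact.eventually self_mem_nhdsWithin] with z hz
  have := q_inv (R := R) (u := z⁻¹) hz
  rw [inv_inv] at this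
  exact this.symm

theorem tendsto_qRow_cocompact (hspec : ∀ z ∈ spectrum ℂ R.aC, 0 < z.re) (p : ℝ≥0∞)
    [Fact (1 ≤ p)] : Tendsto (R.qRow p) (cocompact ℂ) (𝓝 0) := by
  have h := tendsto_pi_nhds.1 (tendsto_q_cocompact hspec)
  have := tendsto_finsetSum (Finset.univ : Finset (Fin m)) fun i _ =>
    (h i).smul_const (PiLp.proj p (𝕜 := ℂ) (fun _ : Fin m => ℂ) i)
  simp only [Pi.zero_apply, zero_smul, Finset.sum_const_zero] at this
  exact this

/-- In the chart at infinity `r` is differentiable, and its value there is `r(∞) = 0`. -/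
theorem isBigO_r_cocompact (hspec : ∀ z ∈ spectrum ℂ R.aC, 0 < z.re)
    (hlim : Tendsto R.r (cocompact ℂ) (𝓝 0)) : R.r =O[cocompact ℂ] fun z => z⁻¹ := by
  set F : ℂ → ℂ := fun u =>
    1 - Matrix.vecMul R.bC (R.aC - u • 1)⁻¹ ⬝ᵥ (fun _ => 1) with hF
  have hFd : DifferentiableAt ℂ F 0 := (differentiableAt_const _).sub
    (differentiableAt_dotProduct_one (differentiableAt_vecMul_infty hspec))
  have hrF : (fun z => F z⁻¹) =ᶠ[cocompact ℂ] R.r := by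
    filter_upwards [tendsto_inv_cocompact.eventually self_mem_nhdsWithin] with z hz
    have h := q_inv (R := R) (u := z⁻¹) hz
    have hz' : z ≠ 0 := by rintro rfl; simp at hz
    rw [inv_inv] at h
    rw [r, h, smul_dotProduct, smul_eq_mul, neg_mul, mul_neg, mul_inv_cancel_left₀ hz', hF,
      ← sub_eq_add_neg]
  have hinv := tendsto_inv_cocompact.mono_right nhdsWithin_le_nhds
  have hF0 : F 0 = 0 :=
    tendsto_nhds_unique ((hFd.continuousAt.tendsto.comp hinv).congr' hrF) hlim
  have hO := (hFd.isBigO_sub).comp_tendsto hinv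
  simp only [hF0, sub_zero] at hO
  exact hO.congr' hrF EventuallyEq.rfl

/-- By the maximum principle `|r| = 1` at an interior point would make `r` constant on the left half
plane, against `r(∞) = 0`. -/
theorem norm_r_lt_one (hspec : ∀ z ∈ spectrum ℂ R.aC, 0 < z.re) (hL : R.IsLStable) {z : ℂ}
    (hz : z.re < 0) : ‖R.r z‖ < 1 := by
  by_contra! hge
  have hU : IsOpen {w : ℂ | w.re < 0} := isOpen_lt Complex.continuous_re continuous_const
  have heq := Complex.eqOn_of_isPreconnected_of_isMaxOn_norm (f := R.r)
    (convex_halfSpace_re_lt 0).isPreconnected hU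
    (fun w hw => (R.differentiableAt_r (det_ne_zero_of_re_nonpos hspec
      (le_of_lt hw))).differentiableWithinAt) hz
    (fun w hw => (hL.1 w (le_of_lt hw)).trans hge)
  have ht : Tendsto (fun T : ℝ => ((-T : ℝ) : ℂ)) atTop (cocompact ℂ) := by
    rw [← Metric.cobounded_eq_cocompact, ← tendsto_norm_atTop_iff_cobounded]
    simpa using tendsto_abs_atTop_atTop
  have hc : Tendsto (fun T : ℝ => R.r ((-T : ℝ) : ℂ)) atTop (𝓝 (R.r z)) := by
    refine tendsto_const_nhds.congr' ?_
    filter_upwards [eventually_gt_atTop 0] with T hT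
    exact (heq (x := ((-T : ℝ) : ℂ)) (by simpa using hT)).symm
  have h0 := tendsto_nhds_unique hc (hL.2.comp ht)
  rw [h0, norm_zero] at hge
  linarith

/-- Away from the imaginary axis the bound `|r| ≤ 1` improves to a decaying one: the maximum of
`|r|` on `Re z ≤ -η` is less than `1`, and `r = O(1 / z)`. -/
theorem exists_norm_r_mul_le_one (hspec : ∀ z ∈ spectrum ℂ R.aC, 0 < z.re) (hL : R.IsLStable)
    {η : ℝ} (hη : 0 < η) :
    ∃ b : ℝ, 0 < b ∧ ∀ z : ℂ, z.re ≤ -η → ‖R.r z‖ * (1 + b * ‖z‖) ≤ 1 := by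
  obtain ⟨z₀, hz₀, hmax⟩ : ∃ x ∈ {z : ℂ | z.re ≤ -η}, IsMaxOn (fun z => ‖R.r z‖) _ x := by
    refine exists_isMaxOn_of_tendsto_zero (isClosed_le Complex.continuous_re continuous_const)
      ⟨((-η : ℝ) : ℂ), by simp⟩ (fun z hz => ?_) (fun _ _ => norm_nonneg _) ?_
    · have hz' : z.re ≤ 0 := le_trans hz (by linarith)
      exact (R.differentiableAt_r
        (det_ne_zero_of_re_nonpos hspec hz')).continuousAt.norm.continuousWithinAt
    · simpa using (hL.2.norm).mono_left inf_le_left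
  have hκ : ‖R.r z₀‖ < 1 := norm_r_lt_one hspec hL (lt_of_le_of_lt hz₀ (by linarith))
  obtain ⟨L, hLb⟩ := (isBigO_r_cocompact hspec hL.2).bound
  rw [← Metric.cobounded_eq_cocompact,
    (Metric.hasBasis_cobounded_compl_closedBall 0).eventually_iff] at hLb
  obtain ⟨T, -, hT⟩ := hLb
  set N := max (max L T) 0 with hN
  have hN0 : 0 ≤ N := le_max_right _ _
  have hNb : ∀ z : ℂ, z.re ≤ -η → ‖R.r z‖ * ‖z‖ ≤ N := fun z hz => by
    by_cases hzT : ‖z‖ ≤ T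
    · calc ‖R.r z‖ * ‖z‖ ≤ 1 * ‖z‖ := by
            gcongr
            exact hL.1 z (by linarith)
        _ ≤ N := by rw [one_mul]; exact hzT.trans ((le_max_right _ _).trans (le_max_left _ _))
    · have hz0 : 0 < ‖z‖ := norm_pos_iff.2 (by rintro rfl; simp at hz; linarith)
      have := hT (x := z) (by simpa using hzT)
      rw [norm_inv, ← div_eq_mul_inv, le_div_iff₀ hz0] at this
      exact this.trans ((le_max_left _ _).trans (le_max_left _ _))
  refine ⟨(1 - ‖R.r z₀‖) / (N + 1), div_pos (by linarith) (by linarith), fun z hz => ?_⟩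
  have h1 : ‖R.r z‖ ≤ ‖R.r z₀‖ := hmax hz
  have h2 := hNb z hz
  have h3 : (1 - ‖R.r z₀‖) / (N + 1) * N ≤ 1 - ‖R.r z₀‖ := by
    rw [div_mul_eq_mul_div, div_le_iff₀ (by linarith)]
    nlinarith
  have h4 : (1 - ‖R.r z₀‖) / (N + 1) * (‖R.r z‖ * ‖z‖) ≤ (1 - ‖R.r z₀‖) / (N + 1) * N := by
    have : 0 ≤ 1 - ‖R.r z₀‖ := by linarith
    gcongr
  calc ‖R.r z‖ * (1 + (1 - ‖R.r z₀‖) / (N + 1) * ‖z‖)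
      = ‖R.r z‖ + (1 - ‖R.r z₀‖) / (N + 1) * (‖R.r z‖ * ‖z‖) := by ring
    _ ≤ 1 := by linarith

theorem eventually_det_ne_zero (R : RKMethod m) : ∀ᶠ z in 𝓝 (0 : ℂ), (1 - z • R.aC).det ≠ 0 := by
  have hc : Continuous fun z : ℂ => (1 - z • R.aC).det :=
    Continuous.matrix_det (by fun_prop)
  exact hc.continuousAt.eventually_ne (by simp)

/-- Near the origin `r` is close to the exponential function, which gains a factor
`e^{-σ|z|}` from the real part. -/
theorem exists_norm_r_le_near_zero (hder : HasDerivAt R.r 1 0) {σ : ℝ} (hσ : 0 < σ) :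
    ∃ ε : ℝ, 0 < ε ∧ ∀ z : ℂ, ‖z‖ ≤ ε → (1 - z • R.aC).det ≠ 0 ∧
      ∀ δ : ℝ, 0 ≤ δ → z.re ≤ δ - σ * ‖z‖ →
        ‖R.r z‖ * (1 + σ / 2 * ‖z‖) ≤ Real.exp (2 * δ) := by
  have hd : HasDerivAt (fun z => R.r z - Complex.exp z) 0 0 := by
    have := hder.sub (Complex.hasDerivAt_exp 0)
    rw [Complex.exp_zero, sub_self] at this
    exact this
  have ho := (hasDerivAt_iff_isLittleO.1 hd).def (c := σ / 6) (by positivity)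
  have hsmall : ∀ᶠ z : ℂ in 𝓝 0, σ * ‖z‖ ≤ 1 := by
    have : Continuous fun z : ℂ => σ * ‖z‖ := by fun_prop
    exact (this.continuousAt.eventually_lt_const (by simp)).mono fun _ h => h.le
  obtain ⟨ε, hε, h⟩ := Metric.nhds_basis_closedBall.eventually_iff.1
    ((ho.and hsmall).and (eventually_det_ne_zero R))
  refine ⟨ε, hε, fun z hz => ?_⟩
  obtain ⟨⟨h1, h2⟩, h3⟩ := h (x := z) (by simpa using hz)
  refine ⟨h3, fun δ hδ hre => ?_⟩
  simp only [r_zero, Complex.exp_zero, sub_self, sub_zero, smul_zero] at h1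
  set x := σ * ‖z‖ with hx
  have hx0 : 0 ≤ x := by positivity
  have e1 : ‖R.r z‖ ≤ Real.exp (δ - x) + x / 6 := by
    calc ‖R.r z‖ = ‖(R.r z - Complex.exp z) + Complex.exp z‖ := by rw [sub_add_cancel]
      _ ≤ σ / 6 * ‖z‖ + Real.exp z.re := by
        refine (norm_add_le _ _).trans (add_le_add h1 ?_)
        rw [Complex.norm_exp]
      _ ≤ x / 6 + Real.exp (δ - x) := by
        refine add_le_add (le_of_eq (by rw [hx]; ring)) (Real.exp_le_exp.2 hre)
      _ = _ := add_comm _ _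
  have e2 : Real.exp (-x) ≤ (1 + x)⁻¹ := by
    rw [Real.exp_neg]
    exact inv_anti₀ (by linarith) (by linarith [Real.add_one_le_exp x])
  have hδ1 : 1 ≤ Real.exp δ := Real.one_le_exp hδ
  have e3 : ‖R.r z‖ ≤ Real.exp δ * ((1 + x)⁻¹ + x / 6) := by
    refine e1.trans ?_
    rw [mul_add, sub_eq_add_neg, Real.exp_add]
    gcongr
    nlinarith
  have e4 : ((1 + x)⁻¹ + x / 6) * (1 + x / 2) ≤ 1 := by
    have : 0 < 1 + x := by linarith
    rw [inv_eq_one_div, div_add_div _ _ this.ne' (by norm_num), div_mul_eq_mul_div,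
      div_le_one (by positivity)]
    nlinarith [mul_nonneg hx0 (sub_nonneg.2 h2),
      mul_nonneg (mul_nonneg hx0 hx0) (sub_nonneg.2 h2)]
  calc ‖R.r z‖ * (1 + σ / 2 * ‖z‖) = ‖R.r z‖ * (1 + x / 2) := by rw [hx]; ring
    _ ≤ Real.exp δ * ((1 + x)⁻¹ + x / 6) * (1 + x / 2) := by gcongr
    _ = Real.exp δ * (((1 + x)⁻¹ + x / 6) * (1 + x / 2)) := by ring
    _ ≤ Real.exp δ * 1 := by gcongr
    _ ≤ Real.exp (2 * δ) := by rw [mul_one]; exact Real.exp_le_exp.2 (by linarith)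

theorem exists_isAdmissible (hspec : ∀ z ∈ spectrum ℂ R.aC, 0 < z.re)
    (hder : HasDerivAt R.r 1 0) (hL : R.IsLStable) {α d : ℝ} (hd : 0 < d) (hαd : 0 < α - d)
    (hαd' : α + d < Real.pi / 2) : ∃ ρ b : ℝ, IsAdmissible R α d ρ b := by
  set σ := Real.sin (α - d) with hσ
  have hσ0 : 0 < σ := Real.sin_pos_of_pos_of_lt_pi hαd (by linarith)
  obtain ⟨ε, hε, hnear⟩ := exists_norm_r_le_near_zero hder hσ0
  obtain ⟨b, hb, hfar⟩ := exists_norm_r_mul_le_one hspec hL (η := σ * ε / 2) (by positivity)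
  refine ⟨σ * ε / 2, min b (σ / 2), by positivity, lt_min hb (by positivity), ?_⟩
  intro δ hδ hδρ z hz
  have hre := re_le_of_mem_hypRegion hd hαd hαd' hδ hz
  have hm0 : 0 < min b (σ / 2) := lt_min hb (by positivity)
  rw [le_div_iff₀ (by positivity)]
  by_cases hzε : ‖z‖ ≤ ε
  · obtain ⟨h1, h2⟩ := hnear z hzε
    refine ⟨h1, le_trans ?_ (h2 δ hδ.le hre)⟩
    gcongr
    exact min_le_right _ _
  · push Not at hzε
    have hre' : z.re ≤ -(σ * ε / 2) := by nlinarith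
    refine ⟨det_ne_zero_of_re_nonpos hspec (hre'.trans (by linarith [mul_pos hσ0 hε])), ?_⟩
    refine le_trans ?_ ((hfar z hre').trans (Real.one_le_exp (by linarith)))
    gcongr
    exact min_le_left _ _

end RKMethod

/-! ### The regions between two hyperbolas -/

section Region

/-- `z = γ(w)` lies on a hyperbola with foci `0` and `2μ`. -/
theorem norm_sub_hyperbola (α : ℝ) {μ : ℝ} (hμ : 0 ≤ μ) (w : ℂ) :
    ‖2 * (μ : ℂ) - hyperbola α μ w‖ - ‖hyperbola α μ w‖ = 2 * μ * Real.sin (α - w.im) := by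
  have e : 2 * (μ : ℂ) - hyperbola α μ w = hyperbola (-α) μ (-w) := by
    have : ((-α : ℝ) : ℂ) + Complex.I * -w = -(α + Complex.I * w) := by push_cast; ring
    rw [hyperbola, hyperbola, this, Complex.sin_neg]
    ring
  have s : -α - (-w).im = -(α - w.im) := by simp; ring
  rw [e, norm_hyperbola _ hμ, norm_hyperbola _ hμ, s, Real.sin_neg, Complex.neg_re, Real.cosh_neg]
  ring

/-- Every point is on the full parametrization, with an argument of the sine normalized by
periodicity and by the symmetry `sin (π - ζ) = sin ζ`. -/
theorem exists_hyperbola_eq (α : ℝ) {μ : ℝ} (hμ : 0 < μ) (z : ℂ) :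
    ∃ w, hyperbola α μ w = z ∧ α - w.im ∈ Set.Icc (-(Real.pi / 2)) (Real.pi / 2) := by
  obtain ⟨ζ, hζ, hre⟩ : ∃ ζ : ℂ, Complex.sin ζ = 1 - z / μ ∧
      ζ.re ∈ Set.Icc (-(Real.pi / 2)) (Real.pi / 2) := by
    obtain ⟨ζ, hζ⟩ := Complex.sin_surjective (1 - z / μ)
    obtain ⟨k, hk, -⟩ := existsUnique_add_zsmul_mem_Ico Real.two_pi_pos ζ.re (-(Real.pi / 2))
    have hs : Complex.sin (ζ + k * (2 * Real.pi)) = 1 - z / μ := by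
      rw [Complex.sin_add_int_mul_two_pi, hζ]
    have hr : (ζ + k * (2 * Real.pi)).re = ζ.re + k • (2 * Real.pi) := by
      simp
    rcases le_total (ζ.re + k • (2 * Real.pi)) (Real.pi / 2) with h | h
    · exact ⟨_, hs, by rw [hr]; exact ⟨hk.1, h⟩⟩
    · refine ⟨Real.pi - (ζ + k * (2 * Real.pi)), by rw [Complex.sin_pi_sub, hs], ?_⟩
      rw [Complex.sub_re, hr, Complex.ofReal_re]
      exact ⟨by linarith [hk.2], by linarith⟩
  have hμ' : (μ : ℂ) ≠ 0 := by exact_mod_cast hμ.ne'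
  refine ⟨-Complex.I * (ζ - α), ?_, ?_⟩
  · have : (α : ℂ) + Complex.I * (-Complex.I * (ζ - α)) = ζ := by
      linear_combination (α - ζ) * Complex.I_sq
    rw [hyperbola, this, hζ]
    field_simp
    ring
  · have : (-Complex.I * (ζ - α)).im = α - ζ.re := by simp
    rwa [this, sub_sub_cancel]

variable {α d : ℝ}

/-- The region between two hyperbolas, described by the difference of the distances to the common
foci `0` and `2μ`. -/
theorem mem_hypRegion_iff (hd : 0 < d) (hαd : 0 < α - d) (hαd' : α + d < Real.pi / 2)
    {μ : ℝ} (hμ : 0 < μ) {z : ℂ} :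
    z ∈ hypRegion α d μ ↔ 2 * μ * Real.sin (α - d) ≤ ‖2 * (μ : ℂ) - z‖ - ‖z‖ ∧
      ‖2 * (μ : ℂ) - z‖ - ‖z‖ ≤ 2 * μ * Real.sin (α + d) := by
  constructor
  · rintro ⟨w, hw, rfl⟩
    obtain ⟨h1, h2⟩ := sin_le_sin_of_mem_strip hαd hαd' hw
    rw [norm_sub_hyperbola α hμ.le]
    exact ⟨by gcongr, by gcongr⟩
  · rintro ⟨h1, h2⟩
    obtain ⟨w, rfl, hw⟩ := exists_hyperbola_eq α hμ z
    rw [norm_sub_hyperbola α hμ.le] at h1 h2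
    refine ⟨w, ?_, rfl⟩
    have h1' := le_of_mul_le_mul_left h1 (by positivity)
    have h2' := le_of_mul_le_mul_left h2 (by positivity)
    change |w.im| ≤ d
    rw [abs_le]
    constructor
    · by_contra! h
      refine h2'.not_gt (Real.sin_lt_sin_of_lt_of_le_pi_div_two ?_ hw.2 (by linarith))
      linarith [hw.1, hw.2]
    · by_contra! h
      refine h1'.not_gt (Real.sin_lt_sin_of_lt_of_le_pi_div_two hw.1 ?_ (by linarith))
      linarith [hw.1, hw.2]

theorem isClosed_hypRegion (hd : 0 < d) (hαd : 0 < α - d) (hαd' : α + d < Real.pi / 2)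
    {μ : ℝ} (hμ : 0 < μ) : IsClosed (hypRegion α d μ) := by
  have : hypRegion α d μ = {z | 2 * μ * Real.sin (α - d) ≤ ‖2 * (μ : ℂ) - z‖ - ‖z‖} ∩
      {z | ‖2 * (μ : ℂ) - z‖ - ‖z‖ ≤ 2 * μ * Real.sin (α + d)} := by
    ext z
    exact mem_hypRegion_iff hd hαd hαd' hμ
  rw [this]
  exact (isClosed_le continuous_const (by fun_prop)).inter
    (isClosed_le (by fun_prop) continuous_const)

/-- The slope `(|2δ - z| - |z|) / δ` of a convex function of `δ` is monotone. -/
theorem mul_norm_sub_le {δ ρ : ℝ} (hδ : 0 ≤ δ) (hδρ : δ ≤ ρ) (z : ℂ) :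
    ρ * (‖2 * (δ : ℂ) - z‖ - ‖z‖) ≤ δ * (‖2 * (ρ : ℂ) - z‖ - ‖z‖) := by
  have hρ : 0 ≤ ρ := hδ.trans hδρ
  have e : (ρ : ℂ) * (2 * (δ : ℂ) - z) =
      (δ : ℂ) * (2 * (ρ : ℂ) - z) - ((ρ - δ : ℝ) : ℂ) * z := by
    push_cast; ring
  have h : ‖(ρ : ℂ) * (2 * (δ : ℂ) - z)‖ ≤ δ * ‖2 * (ρ : ℂ) - z‖ + (ρ - δ) * ‖z‖ := by
    rw [e]
    refine (norm_sub_le _ _).trans_eq ?_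
    rw [norm_mul, norm_mul, Complex.norm_real, Complex.norm_real, Real.norm_of_nonneg hδ,
      Real.norm_of_nonneg (sub_nonneg.2 hδρ)]
  rw [norm_mul, Complex.norm_real, Real.norm_of_nonneg hρ] at h
  linarith

/-- To the left of the inner hyperbola, every point of positive real part is swept by the boundary
of a smaller copy of the region. -/
theorem exists_mem_hypRegion_of_re_pos (hd : 0 < d) (hαd : 0 < α - d) (hαd' : α + d < Real.pi / 2)
    {ρ : ℝ} (hρ : 0 < ρ) {z : ℂ} (hz : 0 < z.re)
    (h : 2 * ρ * Real.sin (α + d) ≤ ‖2 * (ρ : ℂ) - z‖ - ‖z‖) :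
    ∃ δ, 0 < δ ∧ δ ≤ ρ ∧ z ∈ hypRegion α d δ := by
  obtain ⟨hs, -⟩ := sin_add_mem_Ioo hd hαd hαd'
  have hle : ∀ δ : ℝ, 0 ≤ δ → δ ≤ z.re → ‖2 * (δ : ℂ) - z‖ ≤ ‖z‖ := fun δ h0 h1 => by
    refine abs_le_of_sq_le_sq' ?_ (norm_nonneg _) |>.2
    rw [Complex.sq_norm, Complex.sq_norm, Complex.normSq_apply, Complex.normSq_apply]
    have e1 : (2 * (δ : ℂ) - z).re = 2 * δ - z.re := by simp
    have e2 : (2 * (δ : ℂ) - z).im = - z.im := by simp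
    rw [e1, e2]
    nlinarith
  have hzρ : z.re ≤ ρ := by
    by_contra! hlt
    have := hle ρ hρ.le hlt.le
    nlinarith [mul_pos hρ hs]
  have hc : ContinuousOn
      (fun δ : ℝ => ‖2 * (δ : ℂ) - z‖ - ‖z‖ - 2 * δ * Real.sin (α + d)) (Set.Icc z.re ρ) :=
    Continuous.continuousOn (by fun_prop)
  -- `|2δ - z| ≤ |z|` for `δ = Re z`, so the sign changes between `Re z` and `ρ`
  obtain ⟨δ, hδ, h0⟩ := intermediate_value_Icc hzρ hc (show (0 : ℝ) ∈ Set.Icc _ _ from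
    ⟨by nlinarith [hle z.re hz.le le_rfl, mul_pos hz hs], by linarith⟩)
  have hδ0 : 0 < δ := hz.trans_le hδ.1
  refine ⟨δ, hδ0, hδ.2, (mem_hypRegion_iff hd hαd hαd' hδ0).2 ?_⟩
  simp only at h0
  have : Real.sin (α - d) ≤ Real.sin (α + d) :=
    Real.sin_le_sin_of_le_of_le_pi_div_two (by linarith) hαd'.le (by linarith)
  constructor <;> nlinarith

end Region

/-! ### The maximum of `‖q‖` -/

namespace RKMethod

variable {m : ℕ} {R : RKMethod m} {α d ρ b : ℝ}

/-- There are no poles on the far side of the inner boundary curve of `Ω_ρ`: points of positive real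
part there belong to some `Ω_δ` with `δ ≤ ρ`, the others are covered by the assumption on the
spectrum. -/
theorem det_ne_zero_of_left (hspec : ∀ z ∈ spectrum ℂ R.aC, 0 < z.re) (hd : 0 < d)
    (hαd : 0 < α - d) (hαd' : α + d < Real.pi / 2) (hadm : IsAdmissible R α d ρ b) {z : ℂ}
    (h : 2 * ρ * Real.sin (α + d) ≤ ‖2 * (ρ : ℂ) - z‖ - ‖z‖) :
    (1 - z • R.aC).det ≠ 0 := by
  rcases le_or_gt z.re 0 with hz | hz
  · exact det_ne_zero_of_re_nonpos hspec hz
  · obtain ⟨δ, h1, h2, h3⟩ := exists_mem_hypRegion_of_re_pos hd hαd hαd' hadm.1 hz h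
    exact (hadm.2.2 δ h1 h2 z h3).1

theorem isGreatest_qValues (hspec : ∀ z ∈ spectrum ℂ R.aC, 0 < z.re) (p : ℝ≥0∞) [Fact (1 ≤ p)]
    (hd : 0 < d) (hαd : 0 < α - d) (hαd' : α + d < Real.pi / 2) (hadm : IsAdmissible R α d ρ b) :
    IsGreatest (qValues R p α d ρ) (sSup (qValues R p α d ρ)) := by
  obtain ⟨z, hz, hmax⟩ : ∃ x ∈ hypRegion α d ρ, IsMaxOn (fun z => ‖R.qRow p z‖) _ x := by
    refine exists_isMaxOn_of_tendsto_zero (isClosed_hypRegion hd hαd hαd' hadm.1)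
      ⟨_, 0, by simpa [strip] using hd.le, rfl⟩ (fun z hz => ?_) (fun _ _ => norm_nonneg _) ?_
    · exact (R.differentiableAt_qRow p
        (hadm.2.2 ρ hadm.1 le_rfl z hz).1).continuousAt.norm.continuousWithinAt
    · simpa using (tendsto_qRow_cocompact hspec p).norm.mono_left inf_le_left
  have hg : IsGreatest (qValues R p α d ρ) ‖R.qRow p z‖ :=
    ⟨⟨z, hz, rfl⟩, by rintro _ ⟨w, hw, rfl⟩; exact hmax hw⟩
  rwa [hg.csSup_eq]

theorem tendsto_hyperbola_cocompact (α : ℝ) {μ : ℝ} (hμ : 0 < μ) :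
    Tendsto (hyperbola α μ) (comap (abs ∘ Complex.re) atTop) (cocompact ℂ) := by
  rw [← Metric.cobounded_eq_cocompact, ← tendsto_norm_atTop_iff_cobounded]
  have h : Tendsto (fun w : ℂ => μ * (|w.re| + -1)) (comap (abs ∘ Complex.re) atTop) atTop :=
    (tendsto_atTop_add_const_right _ (-1) tendsto_comap).const_mul_atTop hμ
  refine tendsto_atTop_mono (fun w => ?_) h
  rw [norm_hyperbola α hμ.le]
  have h1 := Real.sin_le_one (α - w.im)
  have h2 : |w.re| ≤ Real.cosh w.re := by
    rw [← Real.cosh_abs]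
    have := Real.sinh_lt_cosh |w.re|
    exact (Real.self_le_sinh_iff.2 (abs_nonneg _)).trans this.le
  gcongr
  linarith

/-- The regions `Ω_δ` are not nested, but `Ω_δ \ Ω_ρ` lies on the far side of the inner boundary
curve of `Ω_ρ`, where the maximum principle applies. That side is the image of the strip
`α + d ≤ Re ζ ≤ π - (α + d)` under `ζ ↦ ρ (1 - sin ζ)`, so that the Phragmén–Lindelöf principle in
a strip suffices. -/
theorem norm_qRow_le_of_mem (hspec : ∀ z ∈ spectrum ℂ R.aC, 0 < z.re) (p : ℝ≥0∞) [Fact (1 ≤ p)]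
    (hd : 0 < d) (hαd : 0 < α - d) (hαd' : α + d < Real.pi / 2) (hadm : IsAdmissible R α d ρ b)
    {δ : ℝ} (hδ : 0 < δ) (hδρ : δ ≤ ρ) {z : ℂ} (hz : z ∈ hypRegion α d δ) :
    ‖R.qRow p z‖ ≤ sSup (qValues R p α d ρ) := by
  have hg := isGreatest_qValues hspec p hd hαd hαd' hadm
  have hρ := hadm.1
  rcases le_total (‖2 * (ρ : ℂ) - z‖ - ‖z‖) (2 * ρ * Real.sin (α + d)) with h | h
  · refine hg.2 ⟨z, (mem_hypRegion_iff hd hαd hαd' hρ).2 ⟨?_, h⟩, rfl⟩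
    have h1 := ((mem_hypRegion_iff hd hαd hαd' hδ).1 hz).1
    have h2 := (mul_le_mul_of_nonneg_left h1 hρ.le).trans (mul_norm_sub_le hδ.le hδρ z)
    refine le_of_mul_le_mul_left ?_ hδ
    linarith
  obtain ⟨w, rfl, hw⟩ := exists_hyperbola_eq 0 hρ z
  rw [norm_sub_hyperbola 0 hρ.le] at h
  have h' := le_of_mul_le_mul_left h (by positivity)
  set ζ : ℂ := Complex.I * w with hζ
  have hwζ : w = -Complex.I * ζ := by
    rw [hζ]; linear_combination w * Complex.I_sq
  have him : ∀ u : ℂ, (0 : ℝ) - (-Complex.I * u).im = u.re := fun u => by simp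
  have hre : ∀ u : ℂ, (-Complex.I * u).re = u.im := fun u => by simp
  rw [hwζ, him] at hw h'
  set f : ℂ → _ := fun u => R.qRow p (hyperbola 0 ρ (-Complex.I * u)) with hf
  have hdist : ∀ u : ℂ, ‖2 * (ρ : ℂ) - hyperbola 0 ρ (-Complex.I * u)‖
      - ‖hyperbola 0 ρ (-Complex.I * u)‖ = 2 * ρ * Real.sin u.re := fun u => by
    rw [norm_sub_hyperbola 0 hρ.le, him]
  have hsd : Real.sin (α - d) ≤ Real.sin (α + d) :=
    Real.sin_le_sin_of_le_of_le_pi_div_two (by linarith) hαd'.le (by linarith)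
  have hbd : ∀ u : ℂ, Real.sin u.re = Real.sin (α + d) →
      ‖f u‖ ≤ sSup (qValues R p α d ρ) := fun u hu => by
    refine hg.2 ⟨_, (mem_hypRegion_iff hd hαd hαd' hρ).2 ?_, rfl⟩
    rw [hdist, hu]
    exact ⟨by gcongr, le_rfl⟩
  have hdiff : ∀ u : ℂ, u.re ∈ Set.Icc (α + d) (Real.pi - (α + d)) →
      DifferentiableAt ℂ f u := fun u hu => by
    have hdet : (1 - hyperbola 0 ρ (-Complex.I * u) • R.aC).det ≠ 0 := by
      refine det_ne_zero_of_left hspec hd hαd hαd' hadm ?_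
      rw [hdist]
      have : Real.sin (α + d) ≤ Real.sin u.re := by
        rcases le_total u.re (Real.pi / 2) with h | h
        · exact Real.sin_le_sin_of_le_of_le_pi_div_two (by linarith) h hu.1
        · rw [← Real.sin_pi_sub u.re]
          exact Real.sin_le_sin_of_le_of_le_pi_div_two (by linarith) (by linarith)
            (by linarith [hu.2])
      gcongr
    have h1 : DifferentiableAt ℂ (fun u => hyperbola 0 ρ (-Complex.I * u)) u :=
      DifferentiableAt.fun_comp' u (hasDerivAt_hyperbola 0 ρ _).differentiableAt (by fun_prop)
    exact DifferentiableAt.fun_comp' u (R.differentiableAt_qRow p hdet) h1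
  have hge : α + d ≤ ζ.re := by
    by_contra! hlt
    exact h'.not_gt (Real.sin_lt_sin_of_lt_of_le_pi_div_two hw.1 hαd'.le hlt)
  -- `f` is even bounded, far below the growth that the principle allows
  have hgrowth : f =O[comap (abs ∘ Complex.im) atTop] fun _ => (1 : ℝ) := by
    have hlim : Tendsto f (comap (abs ∘ Complex.im) atTop) (𝓝 0) := by
      refine (tendsto_qRow_cocompact hspec p).comp ((tendsto_hyperbola_cocompact 0 hρ).comp
        (tendsto_comap_iff.2 ?_))
      refine tendsto_comap.congr fun u => ?_
      simp
    exact hlim.isBigO_one ℝ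
  have hclo : DiffContOnCl ℂ f (Complex.re ⁻¹' Set.Ioo (α + d) (Real.pi - (α + d))) := by
    refine DifferentiableOn.diffContOnCl fun u hu => (hdiff u ?_).differentiableWithinAt
    have := closure_minimal (Set.preimage_mono Set.Ioo_subset_Icc_self)
      (isClosed_Icc.preimage Complex.continuous_re) hu
    exact this
  have := PhragmenLindelof.vertical_strip (f := f) (z := ζ) hclo
    ⟨0, div_pos Real.pi_pos (by linarith), 0, by
      simpa using hgrowth.mono inf_le_left⟩
    (fun u hu => hbd u (by rw [hu])) (fun u hu => hbd u (by rw [hu, Real.sin_pi_sub])) hge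
    (by linarith [hw.2])
  rw [hwζ]
  exact this

end RKMethod

/-! ### Powers of `1 + ε cosh x` -/

section RealEstimates

theorem one_add_sq_div_two_le_cosh (x : ℝ) : 1 + x ^ 2 / 2 ≤ Real.cosh x := by
  have h : Real.cosh x = 1 + 2 * Real.sinh (x / 2) ^ 2 := by
    have := Real.cosh_two_mul (x / 2)
    rw [mul_div_cancel₀ _ two_ne_zero, Real.cosh_sq] at this
    linarith
  have h2 : (x / 2) ^ 2 ≤ Real.sinh (x / 2) ^ 2 := by
    rw [← sq_abs, ← sq_abs (Real.sinh _), Real.abs_sinh]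
    gcongr
    exact Real.self_le_sinh_iff.2 (abs_nonneg _)
  rw [h]
  linarith

/-- Bernoulli's inequality and `cosh x ≥ 1 + x² / 2`. -/
theorem inv_one_add_mul_cosh_sub_one_pow_le {ε : ℝ} {n : ℕ} (hε : 0 ≤ ε) (hn : 1 ≤ n * ε) (x : ℝ) :
    ((1 + ε * (Real.cosh x - 1)) ^ n)⁻¹ ≤ 2 * (1 + x ^ 2)⁻¹ := by
  have h1 := one_add_sq_div_two_le_cosh x
  have h0 : 0 ≤ Real.cosh x - 1 := by nlinarith [sq_nonneg x]
  have h2 := one_add_mul_le_pow (a := ε * (Real.cosh x - 1)) (by nlinarith [mul_nonneg hε h0]) n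
  have h3 : (1 + x ^ 2) / 2 ≤ (1 + ε * (Real.cosh x - 1)) ^ n := by
    nlinarith [mul_nonneg (sub_nonneg.2 hn) h0]
  calc _ ≤ ((1 + x ^ 2) / 2)⁻¹ := inv_anti₀ (by positivity) h3
    _ = _ := by rw [inv_div]; rfl

/-- The shift by `ε` costs a factor `e^{2ε}`, since `(1 + 2ε)(1 - ε) ≥ 1` for `ε ≤ 1/2`. -/
theorem inv_one_add_mul_cosh_sub_one_pow_le_exp {ε : ℝ} (n : ℕ) (hε : 0 ≤ ε) (hε' : ε ≤ 1 / 2)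
    (x : ℝ) : ((1 + ε * (Real.cosh x - 1)) ^ n)⁻¹ ≤
      Real.exp (2 * (n * ε)) * ((1 + ε * Real.cosh x) ^ n)⁻¹ := by
  have h1 := Real.one_le_cosh x
  have h2 : 1 + 2 * ε ≤ Real.exp (2 * ε) := by linarith [Real.add_one_le_exp (2 * ε)]
  have h0 : 0 < 1 + ε * (Real.cosh x - 1) := by nlinarith
  have h3 : 1 + ε * Real.cosh x ≤ Real.exp (2 * ε) * (1 + ε * (Real.cosh x - 1)) := by
    refine le_trans ?_ (mul_le_mul_of_nonneg_right h2 h0.le)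
    nlinarith [mul_nonneg hε (sub_nonneg.2 hε'), mul_nonneg (mul_nonneg hε hε) (sub_nonneg.2 h1)]
  have h4 : 0 < 1 + ε * Real.cosh x := by positivity
  rw [← div_eq_mul_inv, le_div_iff₀ (by positivity), inv_mul_le_iff₀ (by positivity)]
  calc (1 + ε * Real.cosh x) ^ n ≤ (Real.exp (2 * ε) * (1 + ε * (Real.cosh x - 1))) ^ n := by
        gcongr
    _ = _ := by
        rw [mul_pow, ← Real.exp_nat_mul, mul_comm]
        congr 2
        ring

/-- With `u = 1 + ε cosh x`, the function `-u^{-N} (2 + e^{-x})` has derivative at least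
`u^{-(N+1)} cosh x`; the summand `e^{-x}` makes up for the vanishing of `sinh` at the origin. -/
theorem integral_inv_one_add_mul_cosh_pow_le {ε X Y : ℝ} {N : ℕ} (hε : 0 ≤ ε)
    (hN : 1 ≤ 2 * (N * ε)) (hX : 0 ≤ X) (hXY : X ≤ Y) :
    ∫ x in X..Y, ((1 + ε * Real.cosh x) ^ (N + 1))⁻¹ ≤ 3 * ((1 + ε * Real.cosh X) ^ N)⁻¹ := by
  have hu : ∀ x, 1 ≤ 1 + ε * Real.cosh x := fun x => by
    have := mul_nonneg hε (Real.cosh_pos x).le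
    linarith
  set Φ : ℝ → ℝ := fun x => -(((1 + ε * Real.cosh x) ^ N)⁻¹ * (2 + Real.exp (-x))) with hΦ
  have hder : ∀ x, HasDerivAt Φ (N * (ε * Real.sinh x) * ((1 + ε * Real.cosh x) ^ (N + 1))⁻¹ *
      (2 + Real.exp (-x)) + ((1 + ε * Real.cosh x) ^ N)⁻¹ * Real.exp (-x)) x := by
    intro x
    have hne : 1 + ε * Real.cosh x ≠ 0 := by linarith [hu x]
    have h1 : HasDerivAt (fun x => 1 + ε * Real.cosh x) (ε * Real.sinh x) x :=
      ((Real.hasDerivAt_cosh x).const_mul ε).const_add 1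
    have h2 := (h1.fun_pow N).fun_inv (pow_ne_zero N hne)
    have h3 : HasDerivAt (fun x => 2 + Real.exp (-x)) (-Real.exp (-x)) x := by
      simpa using ((hasDerivAt_neg x).exp).const_add 2
    convert! (h2.mul h3).neg using 1
    rcases N with _ | k
    · simp
    · simp only [Nat.add_sub_cancel]
      field_simp
      ring
  have hcont : Continuous fun x => ((1 + ε * Real.cosh x) ^ (N + 1))⁻¹ := by
    refine Continuous.inv₀ (by fun_prop) fun x => pow_ne_zero _ (by linarith [hu x])
  have hle := intervalIntegral.integral_le_sub_of_hasDeriv_right_of_le hXY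
    (fun x _ => (hder x).continuousAt.continuousWithinAt)
    (fun x _ => (hder x).hasDerivWithinAt)
    hcont.continuousOn.integrableOn_Icc (fun x hx => ?_)
  · refine hle.trans ?_
    have hY : Φ Y ≤ 0 := by
      have h1 : 0 < 1 + ε * Real.cosh Y := by linarith [hu Y]
      simp only [hΦ, neg_nonpos]
      positivity
    have hX' : -Φ X ≤ ((1 + ε * Real.cosh X) ^ N)⁻¹ * 3 := by
      simp only [hΦ, neg_neg]
      have h1 : 0 < 1 + ε * Real.cosh X := by linarith [hu X]
      have : Real.exp (-X) ≤ 1 := Real.exp_le_one_iff.2 (by linarith)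
      gcongr
      linarith
    linarith
  · have hx0 : 0 ≤ x := hX.trans hx.1.le
    have hs : 0 ≤ Real.sinh x := Real.sinh_nonneg_iff.2 hx0
    have hpos : 0 < 1 + ε * Real.cosh x := by linarith [hu x]
    have he := Real.exp_pos (-x)
    have hc : Real.sinh x + Real.exp (-x) = Real.cosh x := by
      rw [← Real.cosh_sub_sinh]; ring
    have hpow : ((1 + ε * Real.cosh x) ^ (N + 1))⁻¹ ≤ ((1 + ε * Real.cosh x) ^ N)⁻¹ :=
      inv_anti₀ (by positivity) (pow_le_pow_right₀ (hu x) (Nat.le_succ N))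
    set P := ((1 + ε * Real.cosh x) ^ (N + 1))⁻¹ with hP
    have hP0 : 0 < P := by positivity
    have h1 : Real.sinh x * P ≤ N * (ε * Real.sinh x) * P * (2 + Real.exp (-x)) := by
      have e1 : Real.sinh x * P * 1 ≤ Real.sinh x * P * (2 * (N * ε)) := by gcongr
      have e2 : 0 ≤ N * (ε * Real.sinh x) * P * Real.exp (-x) := by positivity
      linarith
    have h2 : P * Real.exp (-x) ≤ ((1 + ε * Real.cosh x) ^ N)⁻¹ * Real.exp (-x) := by gcongr
    have h3 : P * 1 ≤ P * Real.cosh x := by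
      gcongr
      exact Real.one_le_cosh x
    rw [← hc] at h3
    linarith

end RealEstimates

/-! ### Rows of operators -/

section OperatorNorm

theorem norm_piLp_le_mul {ι : Type*} [Fintype ι] {β₁ β₂ : ι → Type*} (p : ℝ≥0∞) [Fact (1 ≤ p)]
    [∀ i, NormedAddCommGroup (β₁ i)] [∀ i, NormedAddCommGroup (β₂ i)] {x : PiLp p β₁}
    {y : PiLp p β₂} {c : ℝ} (hc : 0 ≤ c) (h : ∀ i, ‖x i‖ ≤ c * ‖y i‖) : ‖x‖ ≤ c * ‖y‖ := by
  rcases eq_or_ne p ∞ with rfl | hp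
  · rw [PiLp.norm_eq_ciSup]
    refine Real.iSup_le (fun i => (h i).trans ?_) (by positivity)
    gcongr
    exact PiLp.norm_apply_le y i
  · have hp0 : 0 < p.toReal := ENNReal.toReal_pos (zero_lt_one.trans_le Fact.out).ne' hp
    rw [PiLp.norm_eq_sum hp0, PiLp.norm_eq_sum hp0]
    calc (∑ i, ‖x i‖ ^ p.toReal) ^ (1 / p.toReal)
        ≤ (c ^ p.toReal * ∑ i, ‖y i‖ ^ p.toReal) ^ (1 / p.toReal) := by
          rw [Finset.mul_sum]
          gcongr with i
          rw [← Real.mul_rpow hc (norm_nonneg _)]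
          gcongr
          exact h i
      _ = c * (∑ i, ‖y i‖ ^ p.toReal) ^ (1 / p.toReal) := by
          rw [Real.mul_rpow (by positivity) (by positivity), ← Real.rpow_mul hc,
            mul_one_div_cancel hp0.ne', Real.rpow_one]

variable {m : ℕ} {E : Type*} [NormedAddCommGroup E] [NormedSpace ℂ E]

/-- A row of scalars has on `Eᵐ` no larger norm than on `ℂᵐ`: test with functionals on `E`. -/
theorem norm_sum_smul_comp_proj_le (p : ℝ≥0∞) [Fact (1 ≤ p)] (v : Fin m → ℂ) (T : E →L[ℂ] E) :
    ‖∑ i, v i • T.comp (PiLp.proj p (𝕜 := ℂ) (fun _ : Fin m => E) i)‖ ≤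
      ‖T‖ * ‖∑ i, v i • PiLp.proj p (𝕜 := ℂ) (fun _ : Fin m => ℂ) i‖ := by
  refine ContinuousLinearMap.opNorm_le_bound _ (by positivity) fun g => ?_
  have e : (∑ i, v i • T.comp (PiLp.proj p (𝕜 := ℂ) (fun _ : Fin m => E) i)) g =
      T (∑ i, v i • g i) := by
    simp
  rw [e, mul_assoc]
  refine (T.le_opNorm _).trans (mul_le_mul_of_nonneg_left ?_ (norm_nonneg _))
  refine NormedSpace.norm_le_dual_bound ℂ _ (by positivity) fun l => ?_
  have e2 : l (∑ i, v i • g i) = (∑ i, v i • PiLp.proj p (𝕜 := ℂ) (fun _ : Fin m => ℂ) i)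
      (WithLp.toLp p fun i => l (g i)) := by
    simp
  rw [e2]
  refine (ContinuousLinearMap.le_opNorm _ _).trans ?_
  rw [mul_assoc, mul_comm ‖g‖]
  refine mul_le_mul_of_nonneg_left ?_ (norm_nonneg _)
  exact norm_piLp_le_mul p (norm_nonneg l) fun i => l.le_opNorm _

end OperatorNorm

/-! ### Estimates for the integrand -/

section Integrand

variable {m : ℕ} {R : RKMethod m} {p : ℝ≥0∞} [Fact (1 ≤ p)]
  {E : Type*} [NormedAddCommGroup E] [NormedSpace ℂ E] {A : E →L[ℂ] E}
  {M φ α d ρ b μ h : ℝ}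

theorem differentiableAt_integrandG [CompleteSpace E] (hφ₀ : 0 ≤ φ) (hA : IsSectorial A M φ)
    (hd : 0 < d) (hαd : 0 < α - d) (hαd' : α + d < Real.pi / 2 - φ)
    (hadm : IsAdmissible R α d ρ b) (hμ : 0 < μ) (hh : 0 < h) (hhμ : h * μ ≤ ρ) (n : ℕ) {w : ℂ}
    (hw : w ∈ strip d) : DifferentiableAt ℂ (integrandG R p A α μ h n) w := by
  have hγ : DifferentiableAt ℂ (hyperbola α μ) w := (hasDerivAt_hyperbola α μ w).differentiableAt
  have hdet : (1 - (h * hyperbola α μ w) • R.aC).det ≠ 0 := by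
    rw [ofReal_mul_hyperbola]
    exact (hadm.2.2 _ (mul_pos hh hμ) hhμ _ ⟨w, hw, rfl⟩).1
  have hhγ : DifferentiableAt ℂ (fun w => h * hyperbola α μ w) w := hγ.const_mul _
  have hr : DifferentiableAt ℂ (fun w => R.r (h * hyperbola α μ w)) w :=
    DifferentiableAt.fun_comp' w (R.differentiableAt_r hdet) hhγ
  have hq : DifferentiableAt ℂ (fun w => R.q (h * hyperbola α μ w)) w :=
    DifferentiableAt.fun_comp' w (R.differentiableAt_q hdet) hhγ
  have hγ' : DifferentiableAt ℂ (deriv (hyperbola α μ)) w := by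
    have : deriv (hyperbola α μ) =
        fun w => -(μ * Complex.cos (α + Complex.I * w) * Complex.I) :=
      funext fun w => (hasDerivAt_hyperbola α μ w).deriv
    rw [this]
    fun_prop
  have hu := (hA (hyperbola α μ w) (hyperbola_ne_zero hd hαd (by linarith) hμ hw)
    (abs_arg_hyperbola_le hd hφ₀ hαd hαd' hμ hw)).1
  have hres : DifferentiableAt ℂ
      (fun w => Ring.inverse (algebraMap ℂ (E →L[ℂ] E) (hyperbola α μ w) + A)) w := by
    refine DifferentiableAt.fun_comp' w (g := Ring.inverse)
      (f := fun w => algebraMap ℂ (E →L[ℂ] E) (hyperbola α μ w) + A)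
      (differentiableAt_inverse hu) ?_
    simp only [Algebra.algebraMap_eq_smul_one]
    exact (hγ.smul_const _).add_const _
  refine DifferentiableAt.fun_sum fun i _ => ?_
  refine DifferentiableAt.fun_smul ?_ (hres.clm_comp (differentiableAt_const _))
  exact (((hr.pow n).const_mul _).mul (differentiableAt_pi.1 hq i)).mul hγ'

theorem nonneg_of_isSectorial (hφ : φ ≤ Real.pi) (hA : IsSectorial A M φ) : 0 ≤ M := by
  have := (hA 1 one_ne_zero (by simpa using hφ)).2
  simpa using (norm_nonneg _).trans this

theorem norm_integrandG_le (hspec : ∀ z ∈ spectrum ℂ R.aC, 0 < z.re) (hφ₀ : 0 ≤ φ)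
    (hφ : φ < Real.pi / 2) (hA : IsSectorial A M φ) (hd : 0 < d) (hαd : 0 < α - d)
    (hαd' : α + d < Real.pi / 2 - φ) (hadm : IsAdmissible R α d ρ b) (hμ : 0 < μ) (hh : 0 < h)
    (hhμ : h * μ ≤ ρ) (n : ℕ) {w : ℂ} (hw : w ∈ strip d) :
    ‖integrandG R p A α μ h n w‖ ≤
      constC₀ R p M α d ρ * ‖R.r (h * hyperbola α μ w)‖ ^ n := by
  have hαd'' : α + d < Real.pi / 2 := by linarith
  have hγ0 : 0 < ‖hyperbola α μ w‖ := norm_pos_iff.2 (hyperbola_ne_zero hd hαd hαd'' hμ hw)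
  have hM := nonneg_of_isSectorial (by linarith [Real.pi_pos]) hA
  set T := Ring.inverse (algebraMap ℂ (E →L[ℂ] E) (hyperbola α μ w) + A) with hT
  set z : ℂ := h * hyperbola α μ w with hz
  set S := √((1 + Real.sin (α + d)) / (1 - Real.sin (α + d))) with hS
  set Q := sSup (qValues R p α d ρ) with hQ
  have hTn : ‖T‖ ≤ M / ‖hyperbola α μ w‖ :=
    (hA _ (norm_pos_iff.1 hγ0) (abs_arg_hyperbola_le hd hφ₀ hαd hαd' hμ hw)).2
  have hγ' : ‖deriv (hyperbola α μ) w‖ ≤ S * ‖hyperbola α μ w‖ :=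
    norm_deriv_hyperbola_le hd hαd hαd'' hμ hw
  have hq : ‖R.qRow p z‖ ≤ Q := by
    refine RKMethod.norm_qRow_le_of_mem hspec p hd hαd hαd'' hadm (mul_pos hh hμ) hhμ ?_
    rw [hz, ofReal_mul_hyperbola]
    exact ⟨w, hw, rfl⟩
  have e : integrandG R p A α μ h n w =
      ((2 * Real.pi * Complex.I)⁻¹ * R.r z ^ n * deriv (hyperbola α μ) w) •
        ∑ i, R.q z i • T.comp (PiLp.proj p (𝕜 := ℂ) (fun _ : Fin m => E) i) := by
    rw [integrandG, Finset.smul_sum]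
    refine Finset.sum_congr rfl fun i _ => ?_
    rw [smul_smul]
    congr 1
    ring
  have hc : ‖(2 * Real.pi * Complex.I : ℂ)⁻¹‖ = (2 * Real.pi)⁻¹ := by
    simp [abs_of_pos Real.pi_pos]
  rw [e, norm_smul, norm_mul, norm_mul, norm_pow, hc]
  have hsum := norm_sum_smul_comp_proj_le p (R.q z) T
  have hQ0 : 0 ≤ Q := (norm_nonneg _).trans hq
  calc _ ≤ (2 * Real.pi)⁻¹ * ‖R.r z‖ ^ n * (S * ‖hyperbola α μ w‖) *
        (M / ‖hyperbola α μ w‖ * Q) := by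
        have hpi := Real.pi_pos
        gcongr
        exact hsum.trans (mul_le_mul hTn hq (norm_nonneg _) (by positivity))
    _ = M / (2 * Real.pi) * S * Q * ‖R.r z‖ ^ n := by
        field_simp
    _ = _ := by rw [constC₀]

/-- The admissibility bound along the parametrized strip, made uniform in `Im w` by `sin ≤ 1`. -/
theorem norm_r_pow_le (hadm : IsAdmissible R α d ρ b) (hμ : 0 < μ) (hh : 0 < h)
    (hhμ : h * μ ≤ ρ) (n : ℕ) {w : ℂ} (hw : w ∈ strip d) :
    ‖R.r (h * hyperbola α μ w)‖ ^ n ≤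
      Real.exp (2 * (n * (h * μ))) * ((1 + b * (h * μ) * (Real.cosh w.re - 1)) ^ n)⁻¹ := by
  have hb := hadm.2.1
  have hhμ0 := mul_pos hh hμ
  have h1 := Real.one_le_cosh w.re
  have hr := (hadm.2.2 _ hhμ0 hhμ _ ⟨w, hw, rfl⟩).2
  rw [norm_hyperbola α hhμ0.le] at hr
  have hs := Real.sin_le_one (α - w.im)
  have hpos : 0 < 1 + b * (h * μ) * (Real.cosh w.re - 1) := by
    have := mul_nonneg (mul_pos hb hhμ0).le (sub_nonneg.2 h1)
    linarith
  have hle : ‖R.r (h * hyperbola α μ w)‖ ≤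
      Real.exp (2 * (h * μ)) * (1 + b * (h * μ) * (Real.cosh w.re - 1))⁻¹ := by
    rw [ofReal_mul_hyperbola, ← div_eq_mul_inv]
    refine hr.trans ?_
    rw [← mul_assoc b]
    gcongr
  calc _ ≤ (Real.exp (2 * (h * μ)) * (1 + b * (h * μ) * (Real.cosh w.re - 1))⁻¹) ^ n := by gcongr
    _ = _ := by
      rw [mul_pow, inv_pow, ← Real.exp_nat_mul]
      congr 2
      ring

end Integrand

/-! ### The quadrature error -/

theorem constC₀_nonneg {m : ℕ} {R : RKMethod m} {p : ℝ≥0∞} [Fact (1 ≤ p)] {M α d ρ : ℝ}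
    (hM : 0 ≤ M) : 0 ≤ constC₀ R p M α d ρ := by
  have hQ : 0 ≤ sSup (qValues R p α d ρ) :=
    Real.sSup_nonneg (by rintro _ ⟨z, -, rfl⟩; exact norm_nonneg _)
  have hpi := Real.pi_pos
  rw [constC₀]
  positivity

/-- The error bound in terms of `ε = b h μ` and `n = N + 1`, with the constants that the argument
gives. -/
theorem norm_quadError_integrandG_le {m : ℕ} {R : RKMethod m} {p : ℝ≥0∞} [Fact (1 ≤ p)]
    {E : Type*} [NormedAddCommGroup E] [NormedSpace ℂ E] [CompleteSpace E] {A : E →L[ℂ] E}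
    {M φ α d ρ b μ h τ : ℝ} (hspec : ∀ z ∈ spectrum ℂ R.aC, 0 < z.re) (hφ₀ : 0 ≤ φ)
    (hφ : φ < Real.pi / 2) (hA : IsSectorial A M φ) (hd : 0 < d) (hαd : 0 < α - d)
    (hαd' : α + d < Real.pi / 2 - φ) (hadm : IsAdmissible R α d ρ b) (hμ : 0 < μ) (hh : 0 < h)
    (hhμ : h * μ ≤ ρ) (hτ : 0 < τ) {N : ℕ} (K : ℕ)
    (h1 : 1 ≤ (N + 1 : ℕ) * (b * (h * μ))) (h2 : b * (h * μ) ≤ 1 / 2) :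
    Integrable (fun x : ℝ => integrandG R p A α μ h (N + 1) (x : ℂ)) ∧
    ‖quadError τ K (fun x : ℝ => integrandG R p A α μ h (N + 1) (x : ℂ))‖ ≤
      constC₀ R p M α d ρ * Real.exp (2 * ((N + 1 : ℕ) * (h * μ))) *
        (4 * Real.pi / (Real.exp (2 * Real.pi * d / τ) - 1) +
          6 * (Real.exp (2 * ((N + 1 : ℕ) * (b * (h * μ)))) *
            ((1 + b * (h * μ) * Real.cosh (K * τ)) ^ N)⁻¹)) := by
  have hb := hadm.2.1
  set n := N + 1 with hn
  set ε := b * (h * μ) with hε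
  have hε0 : 0 < ε := by positivity
  set C₀ := constC₀ R p M α d ρ with hC₀
  have hC₀0 : 0 ≤ C₀ := constC₀_nonneg (nonneg_of_isSectorial (by linarith [Real.pi_pos]) hA)
  set D := C₀ * Real.exp (2 * (n * (h * μ))) with hD
  have hD0 : 0 ≤ D := by positivity
  set G : ℂ → PiLp p (fun _ : Fin m => E) →L[ℂ] E := integrandG R p A α μ h n with hG
  have hGd : ∀ w ∈ strip d, DifferentiableAt ℂ G w := fun w hw =>
    differentiableAt_integrandG hφ₀ hA hd hαd hαd' hadm hμ hh hhμ n hw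
  have hGb : ∀ w ∈ strip d, ‖G w‖ ≤ D * ((1 + ε * (Real.cosh w.re - 1)) ^ n)⁻¹ := fun w hw => by
    refine (norm_integrandG_le hspec hφ₀ hφ hA hd hαd hαd' hadm hμ hh hhμ n hw).trans ?_
    rw [hD, mul_assoc]
    exact mul_le_mul_of_nonneg_left (norm_r_pow_le hadm hμ hh hhμ n hw) hC₀0
  have hGb' : ∀ w ∈ strip d, ‖G w‖ ≤ D * 2 * (1 + w.re ^ 2)⁻¹ := fun w hw => by
    refine (hGb w hw).trans ?_
    rw [mul_assoc D]
    exact mul_le_mul_of_nonneg_left (inv_one_add_mul_cosh_sub_one_pow_le hε0.le h1 _) hD0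
  have hreal : ∀ x : ℝ, (x : ℂ) ∈ strip d := fun x => by simpa [strip] using hd.le
  refine ⟨by simpa using integrable_horizontal hGd hGb' (y := 0) (by simpa using hd.le), ?_⟩
  set g : ℝ → ℝ := fun x => D * Real.exp (2 * (n * ε)) * ((1 + ε * Real.cosh x) ^ n)⁻¹ with hg
  have htail := norm_smul_tsum_sub_sum_le (G := fun x : ℝ => G x) (g := g) (K := K)
    (B := D * Real.exp (2 * (n * ε)) * (3 * ((1 + ε * Real.cosh (K * τ)) ^ N)⁻¹)) hτ
    (summable_int_mul_of_bound hd.le hτ hGb')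
    (fun x => by
      refine (hGb x (hreal x)).trans ?_
      simp only [hg, Real.cosh_abs]
      rw [mul_assoc D]
      exact mul_le_mul_of_nonneg_left
        (inv_one_add_mul_cosh_sub_one_pow_le_exp n hε0.le h2 x) hD0)
    (fun x hx y hy hxy => by
      have hx0 : 0 ≤ x := le_trans (by positivity) hx
      have hc : Real.cosh x ≤ Real.cosh y := by
        rw [Real.cosh_le_cosh, abs_of_nonneg hx0, abs_of_nonneg (hx0.trans hxy)]
        exact hxy
      have := Real.cosh_pos x
      simp only [hg]
      gcongr)
    (fun Y hY => by
      rw [hg, intervalIntegral.integral_const_mul]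
      refine mul_le_mul_of_nonneg_left
        (integral_inv_one_add_mul_cosh_pow_le hε0.le ?_ (by positivity) hY) (by positivity)
      rw [hn] at h1
      push_cast at h1
      linarith)
  have htrap := norm_integral_sub_tsum_le hd hτ hGd hGb'
  have esplit : quadError τ K (fun x : ℝ => G x) =
      ((∫ x : ℝ, G x) - τ • ∑' k : ℤ, G ((k * τ : ℝ) : ℂ)) +
        τ • (∑' k : ℤ, G ((k * τ : ℝ) : ℂ)
          - ∑ k ∈ Finset.Icc (-(K : ℤ)) K, G ((k * τ : ℝ) : ℂ)) := by
    rw [quadError, smul_sub]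
    abel
  rw [esplit]
  refine (norm_add_le _ _).trans ((add_le_add htrap htail).trans_eq ?_)
  ring

theorem theorem3 {m : ℕ} (R : RKMethod m)
    (hspec : ∀ z ∈ spectrum ℂ R.aC, 0 < z.re)
    (hder : HasDerivAt R.r 1 0)
    (hL : R.IsLStable)
    (p : ℝ≥0∞) [Fact (1 ≤ p)]
    {E : Type*} [NormedAddCommGroup E] [NormedSpace ℂ E] [CompleteSpace E]
    (A : E →L[ℂ] E) (M φ : ℝ) (hφ₀ : 0 ≤ φ) (hφ : φ < Real.pi / 2)
    (hA : IsSectorial A M φ)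
    (α d : ℝ) (hd : 0 < d) (hαd : 0 < α - d) (hαd' : α + d < Real.pi / 2 - φ) :
    (∃ ρ b : ℝ, IsAdmissible R α d ρ b) ∧
    ∀ ρ b : ℝ, IsAdmissible R α d ρ b →
      IsGreatest (qValues R p α d ρ) (sSup (qValues R p α d ρ)) ∧
      ∀ (C a₀ a₁ a₂ : ℝ),
        C = 20 * constC₀ R p M α d ρ → a₀ = 2 + 3 / 2 * b → a₁ = 2 + 2 * b → a₂ = b / 2 →
      ∀ (μ h t τ : ℝ) (n K : ℕ), 0 < μ → 0 < h → h * μ ≤ ρ → 0 < τ → 1 ≤ K → t = n * h →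
        1 ≤ b * μ * t → b * μ * t ≤ n / 2 →
        MeasureTheory.Integrable (fun x : ℝ => integrandG R p A α μ h n (x : ℂ)) ∧
        ‖quadError τ K (fun x : ℝ => integrandG R p A α μ h n (x : ℂ))‖ ≤
          C * (Real.exp (a₀ * μ * t) / (Real.exp (2 * Real.pi * d / τ) - 1)
            + Real.exp ((a₁ - a₂ * Real.cosh (K * τ)) * μ * t)
            + Real.exp (a₁ * μ * t) *
                (1 + b * μ * t / n * Real.cosh (K * τ)) ^ (-((n : ℤ) - 1))) := by
  have hαd'' : α + d < Real.pi / 2 := by linarith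
  refine ⟨RKMethod.exists_isAdmissible hspec hder hL hd hαd hαd'', fun ρ b hadm => ?_⟩
  refine ⟨RKMethod.isGreatest_qValues hspec p hd hαd hαd'' hadm, ?_⟩
  rintro _ _ _ _ rfl rfl rfl rfl μ h t τ n K hμ hh hhμ hτ - ht h1 h2
  have hb := hadm.2.1
  -- `n = 0` is excluded by `1 ≤ b μ t ≤ n / 2`
  obtain ⟨N, rfl⟩ : ∃ N, n = N + 1 := by
    refine Nat.exists_eq_succ_of_ne_zero ?_
    rintro rfl
    norm_num at h2
    linarith
  have hn0 : (0 : ℝ) < (N + 1 : ℕ) := by positivity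
  have e1 : b * μ * t = (N + 1 : ℕ) * (b * (h * μ)) := by rw [ht]; ring
  have e2 : b * μ * t / (N + 1 : ℕ) = b * (h * μ) := by rw [e1]; field_simp
  have hε : b * (h * μ) ≤ 1 / 2 := by
    rw [← e2, div_le_iff₀ hn0]
    linarith
  obtain ⟨hint, hle⟩ := norm_quadError_integrandG_le hspec hφ₀ hφ hA hd hαd hαd' hadm hμ hh hhμ hτ
    (p := p) (N := N) K (e1 ▸ h1) hε
  refine ⟨hint, hle.trans ?_⟩
  have hpi := Real.pi_pos
  have hC₀ : 0 ≤ constC₀ R p M α d ρ := constC₀_nonneg (nonneg_of_isSectorial (by linarith) hA)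
  have hexp : 0 < Real.exp (2 * Real.pi * d / τ) - 1 := by
    rw [sub_pos, Real.one_lt_exp_iff]
    positivity
  rw [e2]
  have ez : (1 + b * (h * μ) * Real.cosh (K * τ)) ^ (-(((N + 1 : ℕ) : ℤ) - 1)) =
      ((1 + b * (h * μ) * Real.cosh (K * τ)) ^ N)⁻¹ := by
    rw [Nat.cast_succ, add_sub_cancel_right, zpow_neg, zpow_natCast]
  rw [ez]
  set P := ((1 + b * (h * μ) * Real.cosh (K * τ)) ^ N)⁻¹ with hP
  have hP0 : 0 ≤ P := by
    have := Real.cosh_pos (K * τ)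
    positivity
  have ea : Real.exp (2 * ((N + 1 : ℕ) * (h * μ))) = Real.exp (2 * (μ * t)) := by
    rw [ht]; congr 1; ring
  have eb : Real.exp (2 * (μ * t)) * Real.exp (2 * ((N + 1 : ℕ) * (b * (h * μ)))) =
      Real.exp ((2 + 2 * b) * μ * t) := by
    rw [← e1, ← Real.exp_add]; congr 1; ring
  have ec : Real.exp (2 * (μ * t)) ≤ Real.exp ((2 + 3 / 2 * b) * μ * t) :=
    Real.exp_le_exp.2 (by linarith)
  rw [ea]
  calc _ = constC₀ R p M α d ρ * (4 * Real.pi * Real.exp (2 * (μ * t)) /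
          (Real.exp (2 * Real.pi * d / τ) - 1) + 6 * (Real.exp (2 * (μ * t)) *
            Real.exp (2 * ((N + 1 : ℕ) * (b * (h * μ)))) * P)) := by ring
    _ ≤ constC₀ R p M α d ρ * (20 * Real.exp ((2 + 3 / 2 * b) * μ * t) /
          (Real.exp (2 * Real.pi * d / τ) - 1) +
            20 * (Real.exp ((2 + 2 * b) * μ * t) * P)) := by
        rw [eb]
        have : 4 * Real.pi ≤ 20 := by linarith [Real.pi_le_four]
        gcongr
        norm_num
    -- The middle term of the bound is not needed: it is only added here.
    _ ≤ constC₀ R p M α d ρ * (20 * Real.exp ((2 + 3 / 2 * b) * μ * t) /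
          (Real.exp (2 * Real.pi * d / τ) - 1) +
            20 * Real.exp ((2 + 2 * b - b / 2 * Real.cosh (K * τ)) * μ * t) +
            20 * (Real.exp ((2 + 2 * b) * μ * t) * P)) := by
        refine mul_le_mul_of_nonneg_left ?_ hC₀
        linarith [Real.exp_pos ((2 + 2 * b - b / 2 * Real.cosh (K * τ)) * μ * t)]
    _ = _ := by ring
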